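/- Let $m\ge 2$ be an integer and let $M\subset\mathbb C^2$ be a real-analytic (Levi-nonflat) hypersurface which is of generic $m$-infinite type at $p\in M$, i.e. in suitable holomorphic coordinates $(z,w)$, $w=u+iv$, centred at $p$, $M$ is given near $p$ by $v=u^m\psi(z,\bar z,u)$ with $\psi(z,0,u)=\psi(0,\bar z,u)=0$ and $\psi_{z\bar z}(0,0,0)\neq0$. Suppose that $p$ is a non-resonant point of $M$ in the following sense. In admissible coordinates, centred at $p$, in which $M$ is given near $p$ by $$v=h(z,\bar z,u)=\tfrac12u^m\Bigl(\epsilon|z|^2+\sum_{k,l\ge2}h_{kl}(u)z^k\bar z^l\Bigr),\qquad \epsilon=\pm1,$$ let $w=\Theta(z,\chi,\tau)$, $\Theta(0,0,0)=0$, be the holomorphic solution of $\frac{w-\tau}{2i}=h\bigl(z,\chi,\frac{w+\tau}2\bigr)$ (so that the Segre variety of a point $(\xi,\eta)$ is $w=\Theta(z,\bar\xi,\bar\eta)$), and let $$w''=w^m\,\Phi\Bigl(z,w,\frac{w'}{w^m}\Bigr),\qquad \Phi(z,w,\zeta)=O(\zeta^2)\ \text{ holomorphic near }0\in\mathbb C^3,$$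 be the associated ODE, i.e. the one satisfied by all functions $w(z)=\Theta(z,\chi,\tau)$ with small $\chi$ and small $\tau\neq0$. Let $\alpha_j,\beta_j,\gamma_j$ be the Taylor coefficients of $z^j\zeta^2$, $z^j\zeta^3$, $z^j\zeta^4$ of $\Phi(z,0,\zeta)$ at $0$. Non-resonance means that, for some choice of admissible coordinates, the matrix $$\begin{pmatrix}\alpha_0&3\beta_0&\alpha_1&0\\ \alpha_1&3\beta_1&2\alpha_2&\alpha_1\\ 2\beta_0&4\gamma_0&\beta_1&-\beta_0\\ 2\beta_1&2\beta_0\alpha_0+4\gamma_1&2\beta_2&0\end{pmatrix}$$ and its upper right $3\times3$ block (rows $1,2,3$, columns $2,3,4$) are both invertible. Let $\mathfrak{aut}(M,p)$ be the real vector space (Lie algebra) of infinitesimal automorphisms of $(M,p)$, i.e. of germs at $p$ of holomorphic vector fields $X=P\,\partial_z+Q\,\partial_w$ whose real part is tangent to $M$ near $p$. Then $$\dim_{\mathbb R}\mathfrak{aut}(M,p)\le3 .$$ In particular the isotropy subalgebra, consisting of those $X\in\mathfrak{aut}(M,p)$ that vanish at $p$, has real dimension at most $3$. -/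

import Mathlib

open Filter Topology

noncomputable section

namespace InfiniteType

/-- `r` is a real-analytic local defining function, with nonvanishing differential, of the set
`M ⊆ ℂ²` near the point `p ∈ M`. -/
structure IsDefiningFunction (M : Set (ℂ × ℂ)) (p : ℂ × ℂ) (r : ℂ × ℂ → ℝ) : Prop where
  analytic : AnalyticAt ℝ r p
  zero : r p = 0
  regular : fderiv ℝ r p ≠ 0
  mem_iff : ∀ᶠ Z in 𝓝 p, (Z ∈ M ↔ r Z = 0)

/-- The germ `(M, p)` is a (smooth, embedded) real-analytic hypersurface of `ℂ²`. -/
def IsRealAnalyticHypersurfaceAt (M : Set (ℂ × ℂ)) (p : ℂ × ℂ) : Prop :=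
  ∃ r : ℂ × ℂ → ℝ, IsDefiningFunction M p r

/-- `H = (z, w)` is a system of local holomorphic coordinates of `ℂ²` centred at `p`. -/
structure IsCoordinateSystem (p : ℂ × ℂ) (H : ℂ × ℂ → ℂ × ℂ) : Prop where
  analytic : AnalyticAt ℂ H p
  center : H p = 0
  invertible : Function.Bijective (fderiv ℂ H p)

/-- A function `F (z, χ, u)`, holomorphic near the origin of `ℂ³`, such that `F (z, z̄, u)` is real
for all small `(z, u) ∈ ℂ × ℝ`. -/
def IsRealGerm (F : ℂ × ℂ × ℂ → ℂ) : Prop :=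
  AnalyticAt ℂ F 0 ∧
    ∀ᶠ q : ℂ × ℝ in 𝓝 0, (F (q.1, starRingEnd ℂ q.1, (q.2 : ℂ))).im = 0

/-- In the coordinates `H = (z, w)`, `w = u + i v`, the germ of `M` at `p` is
`{ v = F (z, z̄, u) }`. -/
def IsGraphIn (M : Set (ℂ × ℂ)) (p : ℂ × ℂ) (H : ℂ × ℂ → ℂ × ℂ) (F : ℂ × ℂ × ℂ → ℂ) : Prop :=
  ∀ᶠ Z in 𝓝 p,
    (Z ∈ M ↔ (((H Z).2.im : ℝ) : ℂ) = F ((H Z).1, starRingEnd ℂ (H Z).1, (((H Z).2.re : ℝ) : ℂ)))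

/-- The germ `(M, p)` is of generic `m`-infinite type: in suitable normal coordinates it is
`v = u ^ m * ψ (z, z̄, u)` with `ψ (z, 0, u) = ψ (0, χ, u) = 0` and `ψ_{z z̄} (0, 0, 0) ≠ 0`.
The last condition says that `p` is a generic infinite type point; it implies that
`ψ (z, z̄, 0)` is not identically zero, so that `m` is the type, and that `M` is Levi-nonflat. -/
def IsGenericInfiniteType (m : ℕ) (M : Set (ℂ × ℂ)) (p : ℂ × ℂ) : Prop :=
  1 ≤ m ∧ ∃ (H : ℂ × ℂ → ℂ × ℂ) (ψ : ℂ × ℂ × ℂ → ℂ),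
    IsCoordinateSystem p H ∧ IsRealGerm ψ ∧
    (∀ᶠ q : ℂ × ℂ in 𝓝 0, ψ (q.1, 0, q.2) = 0 ∧ ψ (0, q.1, q.2) = 0) ∧
    deriv (fun z => deriv (fun χ => ψ (z, χ, 0)) 0) 0 ≠ 0 ∧
    IsGraphIn M p H (fun q => q.2.2 ^ m * ψ q)

/-- The admissible defining function
`h (z, χ, u) = (1/2) u ^ m (ε z χ + ∑_{k, l ≥ 2} h_{kl} (u) z ^ k χ ^ l)`; the sum over
`k, l ≥ 2` is written as `z² χ² R (z, χ, u)` with `R` holomorphic near the origin. -/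
def admissibleFunction (m : ℕ) (ε : ℝ) (R : ℂ × ℂ × ℂ → ℂ) : ℂ × ℂ × ℂ → ℂ :=
  fun q => (1 / 2) * q.2.2 ^ m * ((ε : ℂ) * q.1 * q.2.1 + q.1 ^ 2 * q.2.1 ^ 2 * R q)

/-- `H` is a system of admissible coordinates for `(M, p)`, in which `M` has the admissible
defining function given by `ε = ±1` and `R`. -/
structure IsAdmissible (m : ℕ) (M : Set (ℂ × ℂ)) (p : ℂ × ℂ)
    (H : ℂ × ℂ → ℂ × ℂ) (ε : ℝ) (R : ℂ × ℂ × ℂ → ℂ) : Prop where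
  coord : IsCoordinateSystem p H
  sign : ε = 1 ∨ ε = -1
  real : IsRealGerm R
  graph : IsGraphIn M p H (admissibleFunction m ε R)

/-- `Θ (z, χ, τ)` is the complex defining function of `{ v = F (z, z̄, u) }`: the holomorphic
solution `w = Θ (z, χ, τ)`, `Θ (0, 0, 0) = 0`, of `(w - τ) / (2 i) = F (z, χ, (w + τ) / 2)`.
The Segre variety of `(ξ, η)` is the graph `w = Θ (z, ξ̄, η̄)`. -/
structure IsComplexDefiningFunction (F Θ : ℂ × ℂ × ℂ → ℂ) : Prop where
  analytic : AnalyticAt ℂ Θ 0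
  zero : Θ 0 = 0
  eqn : ∀ᶠ q : ℂ × ℂ × ℂ in 𝓝 0,
    (Θ q - q.2.2) / (2 * Complex.I) = F (q.1, q.2.1, (Θ q + q.2.2) / 2)

/-- `w'' = w ^ m Φ (z, w, w' / w ^ m)`, with `Φ (z, w, ζ) = O(ζ²)` holomorphic near the origin, is
the singular second order ODE associated with the Segre family `w = Θ (z, χ, τ)`: all functions
`w (z) = Θ (z, χ, τ)`, with `χ`, `τ` small and `τ ≠ 0`, are solutions near `z = 0`. -/
structure IsAssociatedODE (m : ℕ) (Θ Φ : ℂ × ℂ × ℂ → ℂ) : Prop where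
  analytic : AnalyticAt ℂ Φ 0
  order_two : ∀ᶠ q : ℂ × ℂ in 𝓝 0,
    Φ (q.1, q.2, 0) = 0 ∧ deriv (fun ζ => Φ (q.1, q.2, ζ)) 0 = 0
  solves : ∀ᶠ q : ℂ × ℂ × ℂ in 𝓝 0, q.2.2 ≠ 0 →
    iteratedDeriv 2 (fun z => Θ (z, q.2.1, q.2.2)) q.1 =
      Θ q ^ m * Φ (q.1, Θ q, deriv (fun z => Θ (z, q.2.1, q.2.2)) q.1 / Θ q ^ m)

/-- The Taylor coefficient of `z ^ j w ^ 0 ζ ^ k` of `Φ (z, w, ζ)` at the origin. -/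
def coeffAt (Φ : ℂ × ℂ × ℂ → ℂ) (j k : ℕ) : ℂ :=
  iteratedDeriv j (fun z => iteratedDeriv k (fun ζ => Φ (z, 0, ζ)) 0) 0 /
    ((j.factorial : ℂ) * (k.factorial : ℂ))

/-- The `4 × 4` matrix of the non-resonance condition for `m ≥ 2`, where
`α j`, `β j`, `γ j` are the coefficients of `z ^ j ζ ^ 2`, `z ^ j ζ ^ 3`, `z ^ j ζ ^ 4`. -/
def resonanceMatrix (Φ : ℂ × ℂ × ℂ → ℂ) : Matrix (Fin 4) (Fin 4) ℂ :=
  let α := fun j => coeffAt Φ j 2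
  let β := fun j => coeffAt Φ j 3
  let γ := fun j => coeffAt Φ j 4
  !![α 0, 3 * β 0, α 1, 0;
     α 1, 3 * β 1, 2 * α 2, α 1;
     2 * β 0, 4 * γ 0, β 1, -β 0;
     2 * β 1, 2 * β 0 * α 0 + 4 * γ 1, 2 * β 2, 0]

/-- The upper right `3 × 3` block (rows 1-3, columns 2-4) of `resonanceMatrix Φ`. -/
def resonanceMinor (Φ : ℂ × ℂ × ℂ → ℂ) : Matrix (Fin 3) (Fin 3) ℂ :=
  (resonanceMatrix Φ).submatrix Fin.castSucc Fin.succ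

/-- Non-resonance of the ODE `w'' = w ^ m Φ (z, w, w' / w ^ m)`, for `m ≥ 2`. -/
def IsNonResonantODE (Φ : ℂ × ℂ × ℂ → ℂ) : Prop :=
  IsUnit (resonanceMatrix Φ) ∧ IsUnit (resonanceMinor Φ)

/-- `p` is a non-resonant point of the hypersurface `M` of `m`-infinite type, `m ≥ 2`: the ODE
associated with `M` in admissible coordinates is non-resonant. -/
def IsNonResonantAt (m : ℕ) (M : Set (ℂ × ℂ)) (p : ℂ × ℂ) : Prop :=
  ∃ (H : ℂ × ℂ → ℂ × ℂ) (ε : ℝ) (R Θ Φ : ℂ × ℂ × ℂ → ℂ),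
    IsAdmissible m M p H ε R ∧
    IsComplexDefiningFunction (admissibleFunction m ε R) Θ ∧
    IsAssociatedODE m Θ Φ ∧ IsNonResonantODE Φ

/-- The holomorphic vector field `X = P ∂/∂z + Q ∂/∂w`, `X = (P, Q)`, is an infinitesimal
automorphism of `(M, p)`: it is holomorphic near `p` and its real part is tangent to `M` near `p`.
The real vector field `2 Re X` is `Z ↦ (P Z, Q Z)` under `ℂ² = ℝ⁴`, so tangency means
`dr (X) = 0` along `M` for the local defining functions `r` of `M`. -/
def IsInfinitesimalAutomorphism (M : Set (ℂ × ℂ)) (p : ℂ × ℂ) (X : ℂ × ℂ → ℂ × ℂ) : Prop :=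
  AnalyticAt ℂ X p ∧
    ∀ r : ℂ × ℂ → ℝ, IsDefiningFunction M p r →
      ∀ᶠ Z in 𝓝 p, Z ∈ M → fderiv ℝ r Z (X Z) = 0

/-- `𝔞𝔲𝔱 (M, p)`: the real vector space of germs at `p` of infinitesimal automorphisms of `M`. -/
def aut (M : Set (ℂ × ℂ)) (p : ℂ × ℂ) : Submodule ℝ (Germ (𝓝 p) (ℂ × ℂ)) where
  carrier := {g | ∃ X : ℂ × ℂ → ℂ × ℂ, IsInfinitesimalAutomorphism M p X ∧
    (X : Germ (𝓝 p) (ℂ × ℂ)) = g}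
  zero_mem' := ⟨fun _ => 0, ⟨analyticAt_const, fun r _ => by simp⟩, rfl⟩
  add_mem' := by
    rintro _ _ ⟨X, ⟨hX, hXr⟩, rfl⟩ ⟨Y, ⟨hY, hYr⟩, rfl⟩
    refine ⟨X + Y, ⟨hX.add hY, fun r hr => ?_⟩, rfl⟩
    filter_upwards [hXr r hr, hYr r hr] with Z h1 h2 hZ
    simp [h1 hZ, h2 hZ]
  smul_mem' := by
    rintro c _ ⟨X, ⟨hX, hXr⟩, rfl⟩
    refine ⟨c • X, ⟨?_, fun r hr => ?_⟩, rfl⟩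
    · have h : c • X = fun Z => (c : ℂ) • X Z := by
        funext Z
        simp
      rw [h]
      exact (analyticAt_const (v := (c : ℂ))).smul hX
    · filter_upwards [hXr r hr] with Z h1 hZ
      simp [h1 hZ]

/-- The isotropy subalgebra of `𝔞𝔲𝔱 (M, p)`: the infinitesimal automorphisms that vanish at
`p`. -/
def isotropy (M : Set (ℂ × ℂ)) (p : ℂ × ℂ) : Submodule ℝ (Germ (𝓝 p) (ℂ × ℂ)) where
  carrier := {g | g ∈ aut M p ∧ g.value = 0}
  zero_mem' := ⟨(aut M p).zero_mem, rfl⟩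
  add_mem' := by
    rintro ⟨X⟩ ⟨Y⟩ ⟨h1, h2⟩ ⟨h3, h4⟩
    refine ⟨(aut M p).add_mem h1 h3, ?_⟩
    have h2' : X p = 0 := h2
    have h4' : Y p = 0 := h4
    change X p + Y p = 0
    rw [h2', h4', add_zero]
  smul_mem' := by
    rintro c ⟨X⟩ ⟨h1, h2⟩
    refine ⟨(aut M p).smul_mem c h1, ?_⟩
    have h2' : X p = 0 := h2
    change c • X p = 0
    rw [h2', smul_zero]

end InfiniteType

end

/-! Let `X = P ∂_z + Q ∂_w` be an infinitesimal automorphism, written in admissible coordinates. Its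
tangency to `M` complexifies to invariance of the Segre family, so `X` is a point symmetry of the
associated ODE (`segre_tangent`). Because of the Levi term `ε z χ`, the triple `(z, w, ζ)` with `ζ =
w' / w ^ m` gives coordinates on the family (`exists_slope`). Lie's determining equation therefore
holds at all small `(z, w, ζ)` with `w ≠ 0`, and the prolonged field stays bounded as `w → 0`
(`determiningEquation_of_segre`).

Its coefficients of `ζ ^ 0, …, ζ ^ 3`, together with one `z`-derivative of the last two, restrict to
`z = 0` as a linear system in `w`, singular at `w = 0`, for `a = Q`, `b = Q_z`, `p0 = P`, `p1 = P_z`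
(`AxisSystem`; `p2 = P_zz` is eliminated). Suppose these are `w ^ (k+1) A`, `w ^ (m+k) B`, `w ^ k
U`, `w ^ k V`. Since `m ≥ 2`, the lowest-order terms say that the resonance matrix kills the vector
`((k+1-m) A, B, U, V)` at `w = 0`. Invertibility raises all four orders by one, except that `A` is
free when `k + 1 = m`. Boundedness of the prolongation gives the start `k = 0`.

Hence `X` is determined by the coefficient of `w ^ m` in `Q (0, w)`. This is one complex number, so
`𝔞𝔲𝔱 (M, p)` embeds real-linearly in `ℂ` and even has dimension at most 2 (`rank_aut_le`). -/

namespace InfiniteType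

/-! ### Directional derivatives of holomorphic functions. -/

section Directional

variable {E : Type*} [NormedAddCommGroup E] [NormedSpace ℂ E]

/-- The derivative of `F` in the direction `v`. -/
noncomputable def dirDeriv (v : E) (F : E → ℂ) : E → ℂ := fun q => fderiv ℂ F q v

theorem analyticAt_dirDeriv {F : E → ℂ} {q : E} (hF : AnalyticAt ℂ F q) (v : E) :
    AnalyticAt ℂ (dirDeriv v F) q :=
  (ContinuousLinearMap.analyticAt (ContinuousLinearMap.apply ℂ ℂ v) _).comp hF.fderiv

theorem analyticAt_iterate_dirDeriv {F : E → ℂ} {q : E} (hF : AnalyticAt ℂ F q) (v : E) (k : ℕ) :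
    AnalyticAt ℂ ((dirDeriv v)^[k] F) q := by
  induction k with
  | zero => simpa using hF
  | succ k ih =>
    rw [Function.iterate_succ_apply']
    exact analyticAt_dirDeriv ih v

theorem hasFDerivAt_dirDeriv {F : E → ℂ} {q : E} (hF : AnalyticAt ℂ F q) (v : E) :
    HasFDerivAt (dirDeriv v F) ((fderiv ℂ (fderiv ℂ F) q).flip v) q := by
  have h := hF.fderiv.differentiableAt.hasFDerivAt.clm_apply (hasFDerivAt_const v q)
  refine h.congr_fderiv ?_
  ext x
  simp

theorem dirDeriv_comm {F : E → ℂ} {q : E} (hF : AnalyticAt ℂ F q) (v v' : E) :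
    dirDeriv v (dirDeriv v' F) q = dirDeriv v' (dirDeriv v F) q := by
  have hs : IsSymmSndFDerivAt ℂ F q :=
    (hF.contDiffAt (n := 2)).isSymmSndFDerivAt (by simp)
  have h1 := (hasFDerivAt_dirDeriv hF v').fderiv
  have h2 := (hasFDerivAt_dirDeriv hF v).fderiv
  unfold dirDeriv at *
  rw [h1, h2]
  exact hs v v'

theorem dirDeriv_congr {F G : E → ℂ} {q : E} (h : F =ᶠ[𝓝 q] G) (v : E) :
    dirDeriv v F =ᶠ[𝓝 q] dirDeriv v G := by
  filter_upwards [h.fderiv (𝕜 := ℂ)] with x hx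
  simp [dirDeriv, hx]

theorem iterate_dirDeriv_comm {F : E → ℂ} {q : E} (hF : AnalyticAt ℂ F q) (v v' : E) (k : ℕ) :
    dirDeriv v' ((dirDeriv v)^[k] F) q = (dirDeriv v)^[k] (dirDeriv v' F) q := by
  have h : ∀ k, dirDeriv v' ((dirDeriv v)^[k] F) =ᶠ[𝓝 q] (dirDeriv v)^[k] (dirDeriv v' F) := by
    intro k
    induction k with
    | zero => rfl
    | succ k ih =>
      simp only [Function.iterate_succ_apply']
      refine EventuallyEq.trans ?_ (dirDeriv_congr ih v)
      filter_upwards [hF.eventually_analyticAt] with x hx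
      exact dirDeriv_comm (analyticAt_iterate_dirDeriv hx v k) v' v
  exact (h k).self_of_nhds

theorem hasDerivAt_line {F : E → ℂ} {c v : E} {t : ℂ} (hF : AnalyticAt ℂ F (c + t • v)) :
    HasDerivAt (fun s : ℂ => F (c + s • v)) (dirDeriv v F (c + t • v)) t := by
  have hl : HasDerivAt (fun s : ℂ => c + s • v) v t := by
    simpa using ((hasDerivAt_id t).smul_const v).const_add c
  exact hF.differentiableAt.hasFDerivAt.comp_hasDerivAt t hl

/-- Links the one-variable `iteratedDeriv` of `coeffAt` and `IsAssociatedODE` with the directional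
derivatives used in the computations. -/
theorem iteratedDeriv_line {F : E → ℂ} {c v : E} (k : ℕ) :
    ∀ {t : ℂ}, AnalyticAt ℂ F (c + t • v) →
    iteratedDeriv k (fun s : ℂ => F (c + s • v)) t = (dirDeriv v)^[k] F (c + t • v) := by
  induction k with
  | zero => intro t _; simp
  | succ k ih =>
    intro t hF
    rw [iteratedDeriv_succ, Function.iterate_succ_apply']
    have hc : ContinuousAt (fun s : ℂ => c + s • v) t := by fun_prop
    have h : iteratedDeriv k (fun s : ℂ => F (c + s • v)) =ᶠ[𝓝 t]
        fun s => (dirDeriv v)^[k] F (c + s • v) := by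
      filter_upwards [hc.eventually hF.eventually_analyticAt] with s hs
      exact ih hs
    rw [h.deriv_eq]
    exact (hasDerivAt_line (analyticAt_iterate_dirDeriv hF v k)).deriv

end Directional

/-! ### Taylor coefficients in `ζ`. -/

section Coordinates

theorem hasDerivAt_left {F : ℂ × ℂ → ℂ} {z w : ℂ} (hF : AnalyticAt ℂ F (z, w)) :
    HasDerivAt (fun s => F (s, w)) (dirDeriv (1, 0) F (z, w)) z := by
  have h := hasDerivAt_line (F := F) (c := (0, w)) (v := (1, 0)) (t := z) (by simpa using hF)
  simpa using h

theorem hasDerivAt_right {F : ℂ × ℂ → ℂ} {z w : ℂ} (hF : AnalyticAt ℂ F (z, w)) :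
    HasDerivAt (fun s => F (z, s)) (dirDeriv (0, 1) F (z, w)) w := by
  have h := hasDerivAt_line (F := F) (c := (z, 0)) (v := (0, 1)) (t := w) (by simpa using hF)
  simpa using h

/-- The coefficient of `ζ ^ k` of `Φ (z, w, ζ)` as a function of `(z, w)`. -/
noncomputable def zetaCoeff (Φ : ℂ × ℂ × ℂ → ℂ) (k : ℕ) : ℂ × ℂ → ℂ :=
  fun x => (dirDeriv (0, 0, 1))^[k] Φ (x.1, x.2, 0) / (k.factorial : ℂ)

theorem analyticAt_embed (x : ℂ × ℂ) :
    AnalyticAt ℂ (fun x : ℂ × ℂ => ((x.1, x.2, 0) : ℂ × ℂ × ℂ)) x :=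
  analyticAt_fst.prod (analyticAt_snd.prod analyticAt_const)

theorem analyticAt_zetaCoeff {Φ : ℂ × ℂ × ℂ → ℂ} {x : ℂ × ℂ}
    (hΦ : AnalyticAt ℂ Φ (x.1, x.2, 0)) (k : ℕ) : AnalyticAt ℂ (zetaCoeff Φ k) x := by
  have h : AnalyticAt ℂ ((dirDeriv (0, 0, 1))^[k] Φ) (x.1, x.2, 0) :=
    analyticAt_iterate_dirDeriv hΦ _ k
  exact (AnalyticAt.fun_comp (f := fun x : ℂ × ℂ => ((x.1, x.2, 0) : ℂ × ℂ × ℂ)) h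
    (analyticAt_embed x)).div_const

/-- Derivatives in `z` and `w` commute with those in `ζ`; so the `ζ`-expansions of `Φ_z` and `Φ_w`
can be read off from that of `Φ`. -/
theorem dirDeriv_zetaCoeff {Φ : ℂ × ℂ × ℂ → ℂ} {x : ℂ × ℂ}
    (hΦ : AnalyticAt ℂ Φ (x.1, x.2, 0)) (k : ℕ) (v : ℂ × ℂ) :
    dirDeriv v (zetaCoeff Φ k) x = zetaCoeff (dirDeriv (v.1, v.2, 0) Φ) k x := by
  have h : AnalyticAt ℂ ((dirDeriv (0, 0, 1))^[k] Φ) (x.1, x.2, 0) :=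
    analyticAt_iterate_dirDeriv hΦ _ k
  unfold zetaCoeff
  rw [← iterate_dirDeriv_comm hΦ]
  have hl : HasFDerivAt (fun x : ℂ × ℂ => ((x.1, x.2, 0) : ℂ × ℂ × ℂ))
      ((ContinuousLinearMap.fst ℂ ℂ ℂ).prod ((ContinuousLinearMap.snd ℂ ℂ ℂ).prod 0)) x :=
    hasFDerivAt_fst.prodMk (hasFDerivAt_snd.prodMk (hasFDerivAt_const _ _))
  have h2 := (h.differentiableAt.hasFDerivAt.comp x hl).mul_const ((k.factorial : ℂ)⁻¹)
  have h3 := h2.fderiv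
  unfold dirDeriv at *
  simp only [div_eq_mul_inv]
  simp only [Function.comp_def] at h3
  rw [h3]
  simp [mul_comm]

theorem taylor_zeta {Φ : ℂ × ℂ × ℂ → ℂ} {x : ℂ × ℂ} (hΦ : AnalyticAt ℂ Φ (x.1, x.2, 0)) :
    ∃ ρ : ℂ → ℂ, ContinuousAt ρ 0 ∧ ∀ᶠ t in 𝓝 (0 : ℂ), Φ (x.1, x.2, t) =
      zetaCoeff Φ 0 x + zetaCoeff Φ 1 x * t + zetaCoeff Φ 2 x * t ^ 2 + zetaCoeff Φ 3 x * t ^ 3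
        + t ^ 4 * ρ t := by
  have ha : AnalyticAt ℂ (fun t : ℂ => Φ (x.1, x.2, t)) 0 :=
    AnalyticAt.fun_comp (f := fun t : ℂ => ((x.1, x.2, t) : ℂ × ℂ × ℂ)) hΦ (by fun_prop)
  obtain ⟨ρ, hρ, h⟩ := ha.exists_eventuallyEq_sum_add_pow_mul 4
  refine ⟨ρ, hρ.continuousAt, ?_⟩
  have hi : ∀ k, iteratedDeriv k (fun t : ℂ => Φ (x.1, x.2, t)) 0 =
      (dirDeriv (0, 0, 1))^[k] Φ (x.1, x.2, 0) := by
    intro k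
    have := iteratedDeriv_line (F := Φ) (c := (x.1, x.2, 0)) (v := (0, 0, 1)) k (t := 0)
      (by simpa using hΦ)
    simpa using this
  filter_upwards [h] with t ht
  rw [ht]
  simp only [Finset.sum_range_succ, Finset.sum_range_zero, hi, zetaCoeff, smul_eq_mul]
  ring

theorem zetaCoeff_dirDeriv_zeta (Φ : ℂ × ℂ × ℂ → ℂ) (k : ℕ) (x : ℂ × ℂ) :
    zetaCoeff (dirDeriv (0, 0, 1) Φ) k x = (k + 1) * zetaCoeff Φ (k + 1) x := by
  unfold zetaCoeff
  rw [← Function.iterate_succ_apply]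
  have h1 : (k.factorial : ℂ) ≠ 0 := by exact_mod_cast k.factorial_ne_zero
  have h2 : (k + 1 : ℂ) ≠ 0 := by exact_mod_cast k.succ_ne_zero
  rw [Nat.factorial_succ]
  push_cast
  field_simp

theorem coeffAt_eq {Φ : ℂ × ℂ × ℂ → ℂ} (hΦ : AnalyticAt ℂ Φ 0) (j k : ℕ) :
    coeffAt Φ j k = (dirDeriv (1, 0))^[j] (zetaCoeff Φ k) 0 / (j.factorial : ℂ) := by
  have h1 : (fun z : ℂ => iteratedDeriv k (fun ζ => Φ (z, 0, ζ)) 0) =ᶠ[𝓝 0]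
      fun z => (k.factorial : ℂ) * zetaCoeff Φ k (z, 0) := by
    have hc : ContinuousAt (fun z : ℂ => ((z, 0, 0) : ℂ × ℂ × ℂ)) 0 := by fun_prop
    have h0 : AnalyticAt ℂ Φ ((0 : ℂ), 0, 0) := hΦ
    filter_upwards [hc.eventually h0.eventually_analyticAt] with z hz
    have := iteratedDeriv_line (F := Φ) (c := (z, 0, 0)) (v := (0, 0, 1)) k (t := 0)
      (by simpa using hz)
    have hk : (k.factorial : ℂ) ≠ 0 := by exact_mod_cast k.factorial_ne_zero
    simp only [zetaCoeff]
    simp only [Prod.smul_mk, mul_zero, smul_eq_mul, mul_one, Prod.mk_add_mk, add_zero,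
      zero_add] at this
    rw [this]
    field_simp
  unfold coeffAt
  rw [h1.iteratedDeriv_eq]
  have ha : AnalyticAt ℂ (zetaCoeff Φ k) 0 := analyticAt_zetaCoeff (x := 0) hΦ k
  have h2 := iteratedDeriv_line (F := zetaCoeff Φ k) (c := 0) (v := (1, 0)) j (t := 0)
      (by simpa using ha)
  simp only [Prod.smul_mk, mul_zero, smul_eq_mul, mul_one, zero_add, Prod.mk_zero_zero] at h2
  rw [iteratedDeriv_const_mul_field, h2]
  have hk : (k.factorial : ℂ) ≠ 0 := by exact_mod_cast k.factorial_ne_zero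
  field_simp

/-- Let `t → 0`, divide by `t`, and repeat; the remainder only needs to be continuous. -/
theorem cubic_coeffs_eq_zero {c0 c1 c2 c3 : ℂ} {ρ : ℂ → ℂ} (hρ : ContinuousAt ρ 0)
    (h : ∀ᶠ t in 𝓝 (0 : ℂ), c0 + c1 * t + c2 * t ^ 2 + c3 * t ^ 3 + t ^ 4 * ρ t = 0) :
    c0 = 0 ∧ c1 = 0 ∧ c2 = 0 ∧ c3 = 0 := by
  have key : ∀ {c : ℂ} {σ : ℂ → ℂ}, ContinuousAt σ 0 →
      (∀ᶠ t in 𝓝[≠] (0 : ℂ), c + t * σ t = 0) → c = 0 := by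
    intro c σ hσ hc
    have h1 : Tendsto (fun t => c + t * σ t) (𝓝[≠] 0) (𝓝 c) := by
      have : ContinuousAt (fun t => c + t * σ t) 0 := by fun_prop
      have h2 := this.tendsto
      simp only [zero_mul, add_zero] at h2
      exact h2.mono_left nhdsWithin_le_nhds
    have h2 : Tendsto (fun t => c + t * σ t) (𝓝[≠] 0) (𝓝 0) :=
      tendsto_const_nhds.congr' (hc.mono fun t ht => ht.symm)
    exact tendsto_nhds_unique h1 h2
  have h' := h.filter_mono (nhdsWithin_le_nhds (s := {0}ᶜ))
  have hne : ∀ᶠ t : ℂ in 𝓝[≠] 0, t ≠ 0 := self_mem_nhdsWithin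
  have h0 : c0 = 0 := key (σ := fun t => c1 + c2 * t + c3 * t ^ 2 + t ^ 3 * ρ t) (by fun_prop)
    (h'.mono fun t ht => by linear_combination ht)
  subst h0
  have h1 : c1 = 0 := key (σ := fun t => c2 + c3 * t + t ^ 2 * ρ t) (by fun_prop)
    (by filter_upwards [h', hne] with t ht hn
        exact mul_left_cancel₀ hn (by linear_combination ht))
  subst h1
  have h2 : c2 = 0 := key (σ := fun t => c3 + t * ρ t) (by fun_prop)
    (by filter_upwards [h', hne] with t ht hn
        exact mul_left_cancel₀ (pow_ne_zero 2 hn) (by linear_combination ht))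
  subst h2
  have h3 : c3 = 0 := key (σ := ρ) hρ
    (by filter_upwards [h', hne] with t ht hn
        exact mul_left_cancel₀ (pow_ne_zero 3 hn) (by linear_combination ht))
  exact ⟨rfl, rfl, rfl, h3⟩

end Coordinates

/-! ### The determining equation, order by order in `ζ`. -/

section Extraction

/-- The determining equation, at the point `(z, w, ζ)`, of the infinitesimal point symmetries
`P ∂_z + Q ∂_w` of the equation `w'' = w ^ m Φ (z, w, w' / w ^ m)`. -/
def DeterminingEquation (m : ℕ) (Φ : ℂ × ℂ × ℂ → ℂ) (P Q : ℂ × ℂ → ℂ) (q : ℂ × ℂ × ℂ) : Prop :=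
  let x := (q.1, q.2.1)
  let s := q.2.1 ^ m
  let t := q.2.2
  let Qz := dirDeriv (1, 0) Q
  let Qw := dirDeriv (0, 1) Q
  let Pz := dirDeriv (1, 0) P
  let Pw := dirDeriv (0, 1) P
  dirDeriv (1, 0) Qz x + (2 * dirDeriv (0, 1) Qz x - dirDeriv (1, 0) Pz x) * (s * t)
      + (dirDeriv (0, 1) Qw x - 2 * dirDeriv (0, 1) Pz x) * (s * t) ^ 2
      - dirDeriv (0, 1) Pw x * (s * t) ^ 3
      + (Qw x - 2 * Pz x - 3 * Pw x * (s * t)) * (s * Φ q)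
    = s * (P x * dirDeriv (1, 0, 0) Φ q + Q x * dirDeriv (0, 1, 0) Φ q)
      + m * q.2.1 ^ (m - 1) * Q x * (Φ q - t * dirDeriv (0, 0, 1) Φ q)
      + (Qz x + (Qw x - Pz x) * (s * t) - Pw x * (s * t) ^ 2) * dirDeriv (0, 0, 1) Φ q

theorem zetaCoeff_zero_one {Φ : ℂ × ℂ × ℂ → ℂ} (hΦ : AnalyticAt ℂ Φ 0)
    (h2 : ∀ᶠ q : ℂ × ℂ in 𝓝 0, Φ (q.1, q.2, 0) = 0 ∧ deriv (fun ζ => Φ (q.1, q.2, ζ)) 0 = 0) :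
    (zetaCoeff Φ 0 =ᶠ[𝓝 0] fun _ => 0) ∧ (zetaCoeff Φ 1 =ᶠ[𝓝 0] fun _ => 0) := by
  have hc : ContinuousAt (fun x : ℂ × ℂ => ((x.1, x.2, 0) : ℂ × ℂ × ℂ)) 0 := by fun_prop
  have h0 : AnalyticAt ℂ Φ ((0 : ℂ × ℂ).1, (0 : ℂ × ℂ).2, 0) := hΦ
  constructor
  · filter_upwards [h2] with x hx
    simp [zetaCoeff, hx.1]
  · filter_upwards [h2, hc.eventually h0.eventually_analyticAt] with x hx ha
    have h := hasDerivAt_line (F := Φ) (c := (x.1, x.2, 0)) (v := (0, 0, 1)) (t := 0)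
      (by simpa using ha)
    have h' := h.deriv
    simp only [Prod.smul_mk, smul_eq_mul, mul_one, mul_zero, Prod.mk_add_mk, add_zero,
      zero_add] at h'
    simp only [zetaCoeff, Function.iterate_one]
    rw [← h', hx.2]
    simp

/-- The coefficients of `ζ ^ 0, …, ζ ^ 3` of the determining equation. -/
theorem DeterminingEquation.coefficients {m : ℕ} {Φ : ℂ × ℂ × ℂ → ℂ} {P Q : ℂ × ℂ → ℂ}
    (hΦ : AnalyticAt ℂ Φ 0)
    (h2 : ∀ᶠ q : ℂ × ℂ in 𝓝 0, Φ (q.1, q.2, 0) = 0 ∧ deriv (fun ζ => Φ (q.1, q.2, ζ)) 0 = 0)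
    (hDE : ∀ᶠ q : ℂ × ℂ × ℂ in 𝓝 0, q.2.1 ≠ 0 → DeterminingEquation m Φ P Q q) :
    ∀ᶠ x : ℂ × ℂ in 𝓝 0, x.2 ≠ 0 →
      dirDeriv (1, 0) (dirDeriv (1, 0) Q) x = 0 ∧
      x.2 ^ m * (2 * dirDeriv (0, 1) (dirDeriv (1, 0) Q) x
        - dirDeriv (1, 0) (dirDeriv (1, 0) P) x)
        = 2 * zetaCoeff Φ 2 x * dirDeriv (1, 0) Q x ∧
      (x.2 ^ m) ^ 2 * (dirDeriv (0, 1) (dirDeriv (0, 1) Q) x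
        - 2 * dirDeriv (0, 1) (dirDeriv (1, 0) P) x)
        = x.2 ^ m * (P x * dirDeriv (1, 0) (zetaCoeff Φ 2) x)
          + Q x * (x.2 ^ m * dirDeriv (0, 1) (zetaCoeff Φ 2) x
            - m * x.2 ^ (m - 1) * zetaCoeff Φ 2 x)
          + 3 * zetaCoeff Φ 3 x * dirDeriv (1, 0) Q x
          + x.2 ^ m * dirDeriv (0, 1) Q x * zetaCoeff Φ 2 x ∧
      - ((x.2 ^ m) ^ 3 * dirDeriv (0, 1) (dirDeriv (0, 1) P) x)
        - (x.2 ^ m) ^ 2 * dirDeriv (0, 1) P x * zetaCoeff Φ 2 x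
        = x.2 ^ m * (P x * dirDeriv (1, 0) (zetaCoeff Φ 3) x)
          + Q x * (x.2 ^ m * dirDeriv (0, 1) (zetaCoeff Φ 3) x
            - 2 * m * x.2 ^ (m - 1) * zetaCoeff Φ 3 x)
          + 4 * zetaCoeff Φ 4 x * dirDeriv (1, 0) Q x
          + x.2 ^ m * (2 * dirDeriv (0, 1) Q x - dirDeriv (1, 0) P x) * zetaCoeff Φ 3 x := by
  have hc : ContinuousAt (fun x : ℂ × ℂ => ((x.1, x.2, 0) : ℂ × ℂ × ℂ)) 0 := by fun_prop
  have h0 : AnalyticAt ℂ Φ ((0 : ℂ × ℂ).1, (0 : ℂ × ℂ).2, 0) := hΦ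
  -- For fixed `(z, w)` with `w ≠ 0` the equation is an identity of germs in `ζ` at `0`, so Taylor
  -- coefficients may be compared.
  have hcur : ∀ᶠ x : ℂ × ℂ in 𝓝 0, ∀ᶠ t in 𝓝 (0 : ℂ), x.2 ≠ 0 →
      DeterminingEquation m Φ P Q (x.1, x.2, t) := by
    have hc3 : ContinuousAt (fun y : (ℂ × ℂ) × ℂ => ((y.1.1, y.1.2, y.2) : ℂ × ℂ × ℂ)) (0, 0) := by
      fun_prop
    exact (hc3.eventually hDE).curry_nhds
  obtain ⟨hz, ho⟩ := zetaCoeff_zero_one hΦ h2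
  filter_upwards [hc.eventually h0.eventually_analyticAt, hcur, hz, ho,
    dirDeriv_congr hz (1, 0), dirDeriv_congr hz (0, 1), dirDeriv_congr ho (1, 0),
    dirDeriv_congr ho (0, 1)] with x ha hx hz0 ho0 hz1 hz2 ho1 ho2 hx0
  obtain ⟨ρ, hρ, hf⟩ := taylor_zeta (x := x) ha
  obtain ⟨ρ1, hρ1, hf1⟩ := taylor_zeta (x := x) (analyticAt_dirDeriv ha (1, 0, 0))
  obtain ⟨ρ2, hρ2, hf2⟩ := taylor_zeta (x := x) (analyticAt_dirDeriv ha (0, 1, 0))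
  obtain ⟨ρ3, hρ3, hf3⟩ := taylor_zeta (x := x) (analyticAt_dirDeriv ha (0, 0, 1))
  simp only [zetaCoeff_dirDeriv_zeta] at hf3
  simp only [← dirDeriv_zetaCoeff (v := (1, 0)) ha] at hf1
  simp only [← dirDeriv_zetaCoeff (v := (0, 1)) ha] at hf2
  have hzero : ∀ v : ℂ × ℂ, dirDeriv v (fun _ => (0 : ℂ)) x = 0 := fun v => by simp [dirDeriv]
  simp only [hz0, ho0, hz1, hz2, ho1, ho2, hzero] at hf hf1 hf2 hf3
  simp only [DeterminingEquation] at hx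
  set Qz := dirDeriv (1, 0) Q
  set Qw := dirDeriv (0, 1) Q
  set Pz := dirDeriv (1, 0) P
  set Pw := dirDeriv (0, 1) P
  set φ := zetaCoeff Φ
  set s := x.2 ^ m
  set r := (m : ℂ) * x.2 ^ (m - 1)
  -- The witness `ρ` collects everything of order at least 4 in `t`.
  have key := cubic_coeffs_eq_zero
    (c0 := dirDeriv (1, 0) Qz x)
    (c1 := s * (2 * dirDeriv (0, 1) Qz x - dirDeriv (1, 0) Pz x) - 2 * φ 2 x * Qz x)
    (c2 := s ^ 2 * (dirDeriv (0, 1) Qw x - 2 * dirDeriv (0, 1) Pz x)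
      - (s * (P x * dirDeriv (1, 0) (φ 2) x)
          + Q x * (s * dirDeriv (0, 1) (φ 2) x - r * φ 2 x)
          + 3 * φ 3 x * Qz x + s * Qw x * φ 2 x))
    (c3 := - (s ^ 3 * dirDeriv (0, 1) Pw x) - s ^ 2 * Pw x * φ 2 x
      - (s * (P x * dirDeriv (1, 0) (φ 3) x)
          + Q x * (s * dirDeriv (0, 1) (φ 3) x - 2 * r * φ 3 x)
          + 4 * φ 4 x * Qz x + s * (2 * Qw x - Pz x) * φ 3 x))
    (ρ := fun t => (Qw x - 2 * Pz x - 3 * Pw x * (s * t)) * (s * ρ t)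
      - 3 * Pw x * s * (s * φ 3 x)
      - s * (P x * ρ1 t + Q x * ρ2 t) - r * Q x * (ρ t - 4 * φ 4 x - t * ρ3 t)
      - Qz x * ρ3 t - (Qw x - Pz x) * s * (4 * φ 4 x + t * ρ3 t)
      + Pw x * s ^ 2 * (3 * φ 3 x + t * (4 * φ 4 x) + t ^ 2 * ρ3 t))
    (by fun_prop) (by
      filter_upwards [hx, hf, hf1, hf2, hf3] with t ht ht0 ht1 ht2 ht3
      have h := ht hx0
      rw [ht0, ht1, ht2, ht3] at h
      push_cast at h
      linear_combination h)
  obtain ⟨k0, k1, k2, k3⟩ := key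
  refine ⟨k0, by linear_combination k1, by linear_combination k2, ?_⟩
  linear_combination k3

end Extraction
-- The singular linear system along `z = 0` and its leading terms.
section LeadingCoefficients

/-- An identity valid off the origin holds in a whole neighbourhood of each nearby `w ≠ 0`, and so
may be differentiated there. -/
theorem eventually_eventually_punctured {p : ℂ → Prop} (h : ∀ᶠ w in 𝓝[≠] (0 : ℂ), p w) :
    ∀ᶠ w in 𝓝[≠] (0 : ℂ), ∀ᶠ y in 𝓝 w, p y := by
  have h1 := eventually_eventually_nhdsWithin.2 h
  have h2 : ∀ᶠ w : ℂ in 𝓝[≠] 0, w ∈ ({0}ᶜ : Set ℂ) := self_mem_nhdsWithin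
  filter_upwards [h1, h2] with w hw hw0
  rwa [isOpen_compl_singleton.nhdsWithin_eq hw0] at hw

theorem eventually_punctured_analyticAt {F : ℂ → ℂ} (hF : AnalyticAt ℂ F 0) :
    ∀ᶠ w in 𝓝[≠] (0 : ℂ), AnalyticAt ℂ F w :=
  hF.eventually_analyticAt.filter_mono nhdsWithin_le_nhds

/-- The factor `w` keeps the exponent at `j`, which avoids `j - 1` when `j = 0`. -/
theorem mul_deriv_of_eq_pow_mul {f F : ℂ → ℂ} {j : ℕ} (hF : AnalyticAt ℂ F 0)
    (h : ∀ᶠ w in 𝓝[≠] (0 : ℂ), f w = w ^ j * F w) :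
    ∀ᶠ w in 𝓝[≠] (0 : ℂ), w * deriv f w = w ^ j * (j * F w + w * deriv F w) := by
  filter_upwards [eventually_eventually_punctured h, eventually_punctured_analyticAt hF]
    with w hw ha
  have h1 : deriv f w = _ := (EventuallyEq.deriv_eq hw).trans
    ((hasDerivAt_pow j w).mul ha.differentiableAt.hasDerivAt).deriv
  rw [h1]
  rcases j with _ | j
  · simp
  · simp only [Nat.add_sub_cancel]
    push_cast
    ring

theorem sq_mul_deriv_of_eq_pow_mul {f F : ℂ → ℂ} {j : ℕ} (hF : AnalyticAt ℂ F 0)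
    (h : ∀ᶠ w in 𝓝[≠] (0 : ℂ), f w = w ^ j * F w) :
    ∀ᶠ w in 𝓝[≠] (0 : ℂ), w ^ 2 * deriv (deriv f) w =
      w ^ j * (j * (j - 1) * F w + 2 * j * w * deriv F w + w ^ 2 * deriv (deriv F) w) := by
  have h1 := mul_deriv_of_eq_pow_mul hF h
  have hG : AnalyticAt ℂ (fun w => (j * F w + w * deriv F w)) 0 :=
    (analyticAt_const.mul hF).add (analyticAt_id.mul hF.deriv)
  have h2 := mul_deriv_of_eq_pow_mul (f := fun w => w * deriv f w) hG h1
  have hne : ∀ᶠ w : ℂ in 𝓝[≠] 0, w ≠ 0 := self_mem_nhdsWithin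
  filter_upwards [h1, h2, hne, eventually_punctured_analyticAt hF, eventually_eventually_punctured h]
    with w e1 e2 hw ha hfw
  have hfa : AnalyticAt ℂ f w :=
    ((analyticAt_id.pow j).mul ha).congr (hfw.mono fun y hy => by simp [hy])
  have d1 : deriv (fun w => w * deriv f w) w = deriv f w + w * deriv (deriv f) w := by
    have := ((hasDerivAt_id w).mul hfa.deriv.differentiableAt.hasDerivAt).deriv
    simp only [id, one_mul] at this
    exact this
  have d2 : deriv (fun w => (j * F w + w * deriv F w)) w =
      j * deriv F w + (deriv F w + w * deriv (deriv F) w) := by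
    have := ((ha.differentiableAt.hasDerivAt.const_mul (j : ℂ)).add
      ((hasDerivAt_id w).mul ha.deriv.differentiableAt.hasDerivAt)).deriv
    simp only [id, one_mul] at this
    exact this
  rw [d1, d2] at e2
  linear_combination e2 - e1

theorem eq_zero_of_punctured {G : ℂ → ℂ} (hG : ContinuousAt G 0)
    (h : ∀ᶠ w in 𝓝[≠] (0 : ℂ), G w = 0) : G 0 = 0 :=
  tendsto_nhds_unique (hG.tendsto.mono_left nhdsWithin_le_nhds)
    (tendsto_const_nhds.congr' (h.mono fun _ ht => ht.symm))

/-- The functions of `w` by which the ODE enters the singular linear system that its symmetries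
satisfy along `z = 0`. -/
structure AxisCoefficients where
  (f0 f1 f2 f0w f1w g0 g1 g2 g0w g1w h0 h1 : ℂ → ℂ)

/-- The coefficients are continuous, and `f0` is analytic, at the origin. -/
structure AxisCoefficients.Regular (c : AxisCoefficients) : Prop where
  f0 : AnalyticAt ℂ c.f0 0
  f1 : ContinuousAt c.f1 0
  f2 : ContinuousAt c.f2 0
  f0w : ContinuousAt c.f0w 0
  f1w : ContinuousAt c.f1w 0
  g0 : ContinuousAt c.g0 0
  g1 : ContinuousAt c.g1 0
  g2 : ContinuousAt c.g2 0
  g0w : ContinuousAt c.g0w 0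
  g1w : ContinuousAt c.g1w 0
  h0 : ContinuousAt c.h0 0
  h1 : ContinuousAt c.h1 0

/-- The linear system, singular at `w = 0`, that a symmetry satisfies along `z = 0`. -/
structure AxisSystem (m : ℕ) (c : AxisCoefficients) (a b p0 p1 p2 : ℂ → ℂ) (w : ℂ) : Prop where
  e1 : w ^ m * (2 * deriv b w - p2 w) = 2 * c.f0 w * b w
  e2 : (w ^ m) ^ 2 * (deriv (deriv a) w - 2 * deriv p1 w)
    = w ^ m * (p0 w * c.f1 w) + a w * (w ^ m * c.f0w w - m * w ^ (m - 1) * c.f0 w)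
      + 3 * c.g0 w * b w + w ^ m * deriv a w * c.f0 w
  e2' : (w ^ m) ^ 2 * (deriv (deriv b) w - 2 * deriv p2 w)
    = w ^ m * (p1 w * c.f1 w + p0 w * c.f2 w)
      + b w * (w ^ m * c.f0w w - m * w ^ (m - 1) * c.f0 w)
      + a w * (w ^ m * c.f1w w - m * w ^ (m - 1) * c.f1 w)
      + 3 * c.g1 w * b w + w ^ m * (deriv b w * c.f0 w + deriv a w * c.f1 w)
  e3 : - ((w ^ m) ^ 3 * deriv (deriv p0) w) - (w ^ m) ^ 2 * deriv p0 w * c.f0 w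
    = w ^ m * (p0 w * c.g1 w) + a w * (w ^ m * c.g0w w - 2 * m * w ^ (m - 1) * c.g0 w)
      + 4 * c.h0 w * b w + w ^ m * (2 * deriv a w - p1 w) * c.g0 w
  e3' : - ((w ^ m) ^ 3 * deriv (deriv p1) w)
      - (w ^ m) ^ 2 * (deriv p1 w * c.f0 w + deriv p0 w * c.f1 w)
    = w ^ m * (p1 w * c.g1 w + p0 w * c.g2 w)
      + b w * (w ^ m * c.g0w w - 2 * m * w ^ (m - 1) * c.g0 w)
      + a w * (w ^ m * c.g1w w - 2 * m * w ^ (m - 1) * c.g1 w)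
      + 4 * c.h1 w * b w
      + w ^ m * ((2 * deriv b w - p2 w) * c.g0 w + (2 * deriv a w - p1 w) * c.g1 w)

/-- Each of `e2`, `e2'`, `e3`, `e3'` is divisible by `w ^ (m + k)`; the conclusions are the
quotients at `w = 0`. The factor `k + 1 - m` comes from `w ^ m a' - m w ^ (m - 1) a`, and occurs
doubled in the `ζ ^ 3` equations. The terms carrying an extra `w ^ (m - 1)` disappear because `m ≥
2`. -/
theorem AxisSystem.leading {m k : ℕ} (hm : 2 ≤ m) {c : AxisCoefficients} (hc : c.Regular)
    {a b p0 p1 p2 A B U V : ℂ → ℂ}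
    (hA : AnalyticAt ℂ A 0) (hB : AnalyticAt ℂ B 0) (hU : AnalyticAt ℂ U 0)
    (hV : AnalyticAt ℂ V 0)
    (ha : ∀ᶠ w in 𝓝[≠] (0 : ℂ), a w = w ^ (k + 1) * A w)
    (hb : ∀ᶠ w in 𝓝[≠] (0 : ℂ), b w = w ^ (m + k) * B w)
    (hu : ∀ᶠ w in 𝓝[≠] (0 : ℂ), p0 w = w ^ k * U w)
    (hv : ∀ᶠ w in 𝓝[≠] (0 : ℂ), p1 w = w ^ k * V w)
    (hS : ∀ᶠ w in 𝓝[≠] (0 : ℂ), AxisSystem m c a b p0 p1 p2 w) :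
    U 0 * c.f1 0 + (k + 1 - m) * A 0 * c.f0 0 + 3 * c.g0 0 * B 0 = 0 ∧
    V 0 * c.f1 0 + U 0 * c.f2 0 + (k + 1 - m) * A 0 * c.f1 0 + 3 * c.g1 0 * B 0 = 0 ∧
    U 0 * c.g1 0 + 2 * (k + 1 - m) * A 0 * c.g0 0 + 4 * c.h0 0 * B 0 - V 0 * c.g0 0 = 0 ∧
    U 0 * c.g2 0 + 2 * (k + 1 - m) * A 0 * c.g1 0 + 4 * c.h1 0 * B 0
      + 2 * c.f0 0 * B 0 * c.g0 0 = 0 := by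
  obtain ⟨n, rfl⟩ : ∃ n, m = n + 2 := ⟨m - 2, by omega⟩
  obtain ⟨f0r, f1r, f2r, f0wr, f1wr, g0r, g1r, g2r, g0wr, g1wr, h0r, h1r⟩ := hc
  have f0c := f0r.continuousAt
  have hne : ∀ᶠ w : ℂ in 𝓝[≠] 0, w ≠ 0 := self_mem_nhdsWithin
  have da := mul_deriv_of_eq_pow_mul hA ha
  have db := mul_deriv_of_eq_pow_mul hB hb
  have du := mul_deriv_of_eq_pow_mul hU hu
  have dv := mul_deriv_of_eq_pow_mul hV hv
  have dda := sq_mul_deriv_of_eq_pow_mul hA ha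
  have ddb := sq_mul_deriv_of_eq_pow_mul hB hb
  have ddu := sq_mul_deriv_of_eq_pow_mul hU hu
  have ddv := sq_mul_deriv_of_eq_pow_mul hV hv
  -- Equation `e1` solved for `p2` and divided by `w ^ k`; its value at `0` is `-2 f0 B`, again
  -- because `m ≥ 2`.
  set W : ℂ → ℂ := fun w => 2 * w ^ (n + 1) * ((n + 2 + k : ℕ) * B w + w * deriv B w)
    - 2 * c.f0 w * B w with hWdef
  have hW : AnalyticAt ℂ W 0 := by
    have := hB.deriv
    fun_prop
  have hw2 : ∀ᶠ w in 𝓝[≠] (0 : ℂ), p2 w = w ^ k * W w := by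
    filter_upwards [hS, hb, db, hne] with w hs hb db hw
    have h1 := hs.e1
    rw [hb] at h1
    refine mul_left_cancel₀ (pow_ne_zero (n + 3) hw) ?_
    simp only [hWdef]
    linear_combination (-w) * h1 + 2 * w ^ (n + 2) * db
  have dw := mul_deriv_of_eq_pow_mul hW hw2
  have cA := hA.continuousAt
  have cB := hB.continuousAt
  have cU := hU.continuousAt
  have cV := hV.continuousAt
  have cW := hW.continuousAt
  have cA' := hA.deriv.continuousAt
  have cB' := hB.deriv.continuousAt
  have cU' := hU.deriv.continuousAt
  have cV' := hV.deriv.continuousAt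
  have cW' := hW.deriv.continuousAt
  have cA2 := hA.deriv.deriv.continuousAt
  have cB2 := hB.deriv.deriv.continuousAt
  have cU2 := hU.deriv.deriv.continuousAt
  have cV2 := hV.deriv.deriv.continuousAt
  have W0 : W 0 = -(2 * c.f0 0 * B 0) := by simp [hWdef]
  clear_value W
  -- Here and in the next three steps, `G` is one equation of the system, moved to one side and
  -- divided by `w ^ (m + k)`.
  have E2 := eq_zero_of_punctured (G := fun w => U w * c.f1 w
      + A w * (w * c.f0w w - (n + 2 : ℕ) * c.f0 w) + 3 * c.g0 w * B w
      + ((k + 1 : ℕ) * A w + w * deriv A w) * c.f0 w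
      - w ^ (n + 1) * (((k + 1 : ℕ) * ((k + 1 : ℕ) - 1) * A w + 2 * (k + 1 : ℕ) * w * deriv A w
        + w ^ 2 * deriv (deriv A) w) - 2 * (k * V w + w * deriv V w))) (by fun_prop) (by
    filter_upwards [hS, ha, hb, hu, da, dda, dv, hne] with w hs ha hb hu da dda dv hw
    have h := hs.e2
    rw [ha, hb, hu] at h
    simp only [show n + 2 - 1 = n + 1 from rfl] at h
    refine mul_left_cancel₀ (pow_ne_zero (n + 2 + k) hw) ?_
    linear_combination (-1) * h - w ^ (n + 1) * c.f0 w * da + w ^ (2 * n + 2) * dda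
      - 2 * w ^ (2 * n + 3) * dv)
  have E2' := eq_zero_of_punctured (G := fun w => V w * c.f1 w + U w * c.f2 w
      + B w * w ^ (n + 1) * (w * c.f0w w - (n + 2 : ℕ) * c.f0 w)
      + A w * (w * c.f1w w - (n + 2 : ℕ) * c.f1 w) + 3 * c.g1 w * B w
      + ((n + 2 + k : ℕ) * B w + w * deriv B w) * w ^ (n + 1) * c.f0 w
      + ((k + 1 : ℕ) * A w + w * deriv A w) * c.f1 w
      - w ^ (n + 1) * (w ^ (n + 1) * ((n + 2 + k : ℕ) * ((n + 2 + k : ℕ) - 1) * B w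
        + 2 * (n + 2 + k : ℕ) * w * deriv B w
        + w ^ 2 * deriv (deriv B) w) - 2 * (k * W w + w * deriv W w))) (by fun_prop) (by
    filter_upwards [hS, ha, hb, hu, hv, da, db, ddb, dw, hne]
      with w hs ha hb hu hv da db ddb dw hw
    have h := hs.e2'
    rw [ha, hb, hu, hv] at h
    simp only [show n + 2 - 1 = n + 1 from rfl] at h
    refine mul_left_cancel₀ (pow_ne_zero (n + 2 + k) hw) ?_
    linear_combination (-1) * h - w ^ (n + 1) * c.f1 w * da - w ^ (n + 1) * c.f0 w * db
      + w ^ (2 * n + 2) * ddb - 2 * w ^ (2 * n + 3) * dw)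
  have E3 := eq_zero_of_punctured (G := fun w => U w * c.g1 w
      + A w * (w * c.g0w w - 2 * (n + 2 : ℕ) * c.g0 w) + 4 * c.h0 w * B w
      + (2 * ((k + 1 : ℕ) * A w + w * deriv A w) - V w) * c.g0 w
      + w ^ (2 * n + 2) * (k * (k - 1) * U w + 2 * k * w * deriv U w + w ^ 2 * deriv (deriv U) w)
      + w ^ (n + 1) * (k * U w + w * deriv U w) * c.f0 w) (by fun_prop) (by
    filter_upwards [hS, ha, hb, hu, hv, da, du, ddu, hne] with w hs ha hb hu hv da du ddu hw
    have h := hs.e3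
    rw [ha, hb, hu, hv] at h
    simp only [show n + 2 - 1 = n + 1 from rfl] at h
    refine mul_left_cancel₀ (pow_ne_zero (n + 2 + k) hw) ?_
    linear_combination (-1) * h - 2 * w ^ (n + 1) * c.g0 w * da
      - w ^ (3 * n + 4) * ddu - w ^ (2 * n + 3) * c.f0 w * du)
  -- The term `-W g0` produces `2 f0 B g0`, the source of the entry `2 β₀ α₀` of the matrix; the two
  -- terms `V g1` cancel, whence its last entry `0`.
  have E3' := eq_zero_of_punctured (G := fun w => V w * c.g1 w + U w * c.g2 w
      + B w * w ^ (n + 1) * (w * c.g0w w - 2 * (n + 2 : ℕ) * c.g0 w)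
      + A w * (w * c.g1w w - 2 * (n + 2 : ℕ) * c.g1 w) + 4 * c.h1 w * B w
      + (2 * ((n + 2 + k : ℕ) * B w + w * deriv B w) * w ^ (n + 1) - W w) * c.g0 w
      + (2 * ((k + 1 : ℕ) * A w + w * deriv A w) - V w) * c.g1 w
      + w ^ (2 * n + 2) * (k * (k - 1) * V w + 2 * k * w * deriv V w + w ^ 2 * deriv (deriv V) w)
      + w ^ (n + 1) * ((k * V w + w * deriv V w) * c.f0 w + (k * U w + w * deriv U w) * c.f1 w))
      (by fun_prop) (by
    filter_upwards [hS, ha, hb, hu, hv, hw2, da, db, du, dv, ddv, hne]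
      with w hs ha hb hu hv hw2 da db du dv ddv hw
    have h := hs.e3'
    rw [ha, hb, hu, hv, hw2] at h
    simp only [show n + 2 - 1 = n + 1 from rfl] at h
    refine mul_left_cancel₀ (pow_ne_zero (n + 2 + k) hw) ?_
    linear_combination (-1) * h - 2 * w ^ (n + 1) * c.g1 w * da
      - 2 * w ^ (n + 1) * c.g0 w * db
      - w ^ (3 * n + 4) * ddv - w ^ (2 * n + 3) * c.f0 w * dv - w ^ (2 * n + 3) * c.f1 w * du)
  simp only [W0] at E3' E2'
  simp only [ne_eq, Nat.add_eq_zero_iff, one_ne_zero, and_false, not_false_eq_true, zero_pow,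
    zero_mul, mul_zero, add_zero, sub_zero, zero_sub, OfNat.ofNat_ne_zero] at E2 E2' E3 E3'
  push_cast at E2 E2' E3 E3' ⊢
  refine ⟨?_, ?_, ?_, ?_⟩
  · linear_combination E2
  · linear_combination E2'
  · linear_combination E3
  · linear_combination E3'

theorem le_analyticOrderAt_succ {f F : ℂ → ℂ} {j : ℕ} (hf : AnalyticAt ℂ f 0)
    (hF : AnalyticAt ℂ F 0) (h : ∀ᶠ w in 𝓝 (0 : ℂ), f w = w ^ j * F w) (h0 : F 0 = 0) :
    ((j + 1 : ℕ) : ℕ∞) ≤ analyticOrderAt f 0 := by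
  have h1 : ((1 : ℕ) : ℕ∞) ≤ analyticOrderAt F 0 := by
    rw [Nat.cast_one, Order.one_le_iff_ne_zero]
    exact hF.analyticOrderAt_ne_zero.2 h0
  obtain ⟨G, hG, hFG⟩ := (natCast_le_analyticOrderAt hF).1 h1
  refine (natCast_le_analyticOrderAt hf).2 ⟨G, hG, ?_⟩
  filter_upwards [h, hFG] with w h1 h2
  rw [h1, h2]
  simp only [sub_zero, smul_eq_mul]
  ring

theorem exists_eq_pow_mul {f : ℂ → ℂ} {j : ℕ} (hf : AnalyticAt ℂ f 0)
    (h : (j : ℕ∞) ≤ analyticOrderAt f 0) :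
    ∃ F, AnalyticAt ℂ F 0 ∧ ∀ᶠ w in 𝓝 (0 : ℂ), f w = w ^ j * F w := by
  obtain ⟨F, hF, hfF⟩ := (natCast_le_analyticOrderAt hf).1 h
  exact ⟨F, hF, by simpa using hfF⟩

theorem eventually_eq_zero_of_forall_le {f : ℂ → ℂ}
    (h : ∀ k : ℕ, (k : ℕ∞) ≤ analyticOrderAt f 0) : ∀ᶠ w in 𝓝 (0 : ℂ), f w = 0 :=
  analyticOrderAt_eq_top.1 (ENat.eq_top_iff_forall_ge.2 h)

/-- Uniqueness for the singular system: at a non-resonant point, a solution of the expected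
vanishing order at `w = 0` is determined by the coefficient of `w ^ m` of `a`. -/
theorem AxisSystem.eq_zero {m : ℕ} (hm : 2 ≤ m) {c : AxisCoefficients} (hc : c.Regular)
    (hreg : ∀ A B U V : ℂ,
      U * c.f1 0 + A * c.f0 0 + 3 * c.g0 0 * B = 0 →
      V * c.f1 0 + U * c.f2 0 + A * c.f1 0 + 3 * c.g1 0 * B = 0 →
      U * c.g1 0 + 2 * A * c.g0 0 + 4 * c.h0 0 * B - V * c.g0 0 = 0 →
      U * c.g2 0 + 2 * A * c.g1 0 + 4 * c.h1 0 * B + 2 * c.f0 0 * B * c.g0 0 = 0 →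
      A = 0 ∧ B = 0 ∧ U = 0 ∧ V = 0)
    {a b p0 p1 p2 : ℂ → ℂ} (ha : AnalyticAt ℂ a 0) (hb : AnalyticAt ℂ b 0)
    (hp0 : AnalyticAt ℂ p0 0) (hp1 : AnalyticAt ℂ p1 0)
    (ha0 : a 0 = 0) (hb0 : (m : ℕ∞) ≤ analyticOrderAt b 0)
    (ham : iteratedDeriv m a 0 = 0)
    (hS : ∀ᶠ w in 𝓝[≠] (0 : ℂ), AxisSystem m c a b p0 p1 p2 w) :
    ∀ᶠ w in 𝓝 (0 : ℂ), a w = 0 ∧ b w = 0 ∧ p0 w = 0 ∧ p1 w = 0 := by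
  have key : ∀ k : ℕ, ((k + 1 : ℕ) : ℕ∞) ≤ analyticOrderAt a 0 ∧
      ((m + k : ℕ) : ℕ∞) ≤ analyticOrderAt b 0 ∧ ((k : ℕ) : ℕ∞) ≤ analyticOrderAt p0 0 ∧
      ((k : ℕ) : ℕ∞) ≤ analyticOrderAt p1 0 := by
    intro k
    induction k with
    | zero =>
      refine ⟨?_, by simpa using hb0, by simp, by simp⟩
      rw [zero_add, Nat.cast_one, Order.one_le_iff_ne_zero]
      exact ha.analyticOrderAt_ne_zero.2 ha0
    | succ k ih =>
      obtain ⟨i1, i2, i3, i4⟩ := ih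
      obtain ⟨A, hA, haA⟩ := exists_eq_pow_mul ha i1
      obtain ⟨B, hB, hbB⟩ := exists_eq_pow_mul hb i2
      obtain ⟨U, hU, hpU⟩ := exists_eq_pow_mul hp0 i3
      obtain ⟨V, hV, hpV⟩ := exists_eq_pow_mul hp1 i4
      obtain ⟨l1, l2, l3, l4⟩ := AxisSystem.leading hm hc hA hB hU hV
        (haA.filter_mono nhdsWithin_le_nhds) (hbB.filter_mono nhdsWithin_le_nhds)
        (hpU.filter_mono nhdsWithin_le_nhds) (hpV.filter_mono nhdsWithin_le_nhds) hS
      -- The factor `k + 1 - m` is absorbed into the first unknown, so the same matrix serves every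
      -- `k`.
      obtain ⟨r1, r2, r3, r4⟩ := hreg ((k + 1 - m) * A 0) (B 0) (U 0) (V 0) l1 l2
        (by linear_combination l3) (by linear_combination l4)
      refine ⟨?_, le_analyticOrderAt_succ hb hB hbB r2, le_analyticOrderAt_succ hp0 hU hpU r3,
        le_analyticOrderAt_succ hp1 hV hpV r4⟩
      -- In this one case the system says nothing about `A 0`, and the hypothesis on the `m`-th
      -- derivative replaces it.
      by_cases hk : k + 1 = m
      · rw [natCast_le_analyticOrderAt_iff_iteratedDeriv_eq_zero ha] at i1 ⊢
        intro i hi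
        rcases Nat.lt_succ_iff_lt_or_eq.1 hi with h | h
        · exact i1 i h
        · rw [h, hk, ham]
      · have hk' : (k + 1 - m : ℂ) ≠ 0 := by
          rw [sub_ne_zero]
          exact_mod_cast hk
        exact le_analyticOrderAt_succ ha hA haA ((mul_eq_zero.1 r1).resolve_left hk')
  filter_upwards [
    eventually_eq_zero_of_forall_le (f := a) fun k => le_trans (by simp) (key k).1,
    eventually_eq_zero_of_forall_le (f := b) fun k => le_trans (by simp) (key k).2.1,
    eventually_eq_zero_of_forall_le (f := p0) fun k => (key k).2.2.1,
    eventually_eq_zero_of_forall_le (f := p1) fun k => (key k).2.2.2] with w h1 h2 h3 h4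
  exact ⟨h1, h2, h3, h4⟩

end LeadingCoefficients
-- From the determining equation to the axis system.
section Uniqueness

/-- By induction on `j ≤ m`: if `f = w ^ j F` with `j < m`, the bound divided by `‖w‖ ^ j` forces `F
→ 0`. -/
theorem le_analyticOrderAt_of_norm_le {f : ℂ → ℂ} {m : ℕ} {C : ℝ} (hf : AnalyticAt ℂ f 0)
    (h : ∀ᶠ w in 𝓝 (0 : ℂ), ‖f w‖ ≤ C * ‖w‖ ^ m) : (m : ℕ∞) ≤ analyticOrderAt f 0 := by
  suffices H : ∀ j ≤ m, (j : ℕ∞) ≤ analyticOrderAt f 0 from H m le_rfl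
  intro j
  induction j with
  | zero => simp
  | succ j ih =>
    intro hj
    obtain ⟨F, hF, hfF⟩ := exists_eq_pow_mul hf (ih (by omega))
    refine le_analyticOrderAt_succ hf hF hfF ?_
    obtain ⟨i, rfl⟩ : ∃ i, m = j + 1 + i := ⟨m - (j + 1), by omega⟩
    have hne : ∀ᶠ w : ℂ in 𝓝[≠] 0, w ≠ 0 := self_mem_nhdsWithin
    have hb : ∀ᶠ w in 𝓝[≠] (0 : ℂ), ‖F w‖ ≤ C * ‖w‖ ^ (i + 1) := by
      filter_upwards [h.filter_mono nhdsWithin_le_nhds, hfF.filter_mono nhdsWithin_le_nhds, hne]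
        with w h1 h2 hw
      have hp : 0 < ‖w‖ ^ j := pow_pos (norm_pos_iff.2 hw) j
      rw [h2, norm_mul, norm_pow] at h1
      refine le_of_mul_le_mul_left ?_ hp
      calc _ ≤ _ := h1
        _ = _ := by ring
    have hc : ContinuousAt (fun w : ℂ => C * ‖w‖ ^ (i + 1)) 0 := by fun_prop
    have ht := hc.tendsto
    simp only [norm_zero, ne_eq, Nat.add_eq_zero_iff, one_ne_zero, and_false, not_false_eq_true,
      zero_pow, mul_zero] at ht
    have h0 : Tendsto F (𝓝[≠] 0) (𝓝 0) :=
      squeeze_zero_norm' hb (ht.mono_left nhdsWithin_le_nhds)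
    exact tendsto_nhds_unique (hF.continuousAt.tendsto.mono_left nhdsWithin_le_nhds) h0

theorem eventually_axis {p : ℂ × ℂ → Prop} (h : ∀ᶠ x in 𝓝 (0 : ℂ × ℂ), p x) :
    ∀ᶠ w in 𝓝 (0 : ℂ), p (0, w) := by
  have hc : ContinuousAt (fun w : ℂ => ((0, w) : ℂ × ℂ)) 0 := by fun_prop
  exact hc.eventually h

/-- Points with `w = 0` are limits of points with `w ≠ 0` on the same vertical line. -/
theorem eventuallyEq_zero_of_ne {F : ℂ × ℂ → ℂ} (hF : AnalyticAt ℂ F 0)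
    (h : ∀ᶠ x : ℂ × ℂ in 𝓝 0, x.2 ≠ 0 → F x = 0) : F =ᶠ[𝓝 0] fun _ => 0 := by
  filter_upwards [h.eventually_nhds, hF.eventually_analyticAt] with x hx ha
  have hc : ContinuousAt (fun w : ℂ => F (x.1, w)) x.2 :=
    ContinuousAt.comp (f := fun w : ℂ => ((x.1, w) : ℂ × ℂ)) (x := x.2) (g := F)
      ha.continuousAt (by fun_prop)
  have hl : ContinuousAt (fun w : ℂ => ((x.1, w) : ℂ × ℂ)) x.2 := by fun_prop
  have h1 : ∀ᶠ w in 𝓝[≠] x.2, F (x.1, w) = 0 := by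
    have hw : ∀ᶠ w in 𝓝[≠] x.2, w ≠ 0 := by
      by_cases h0 : x.2 = 0
      · rw [h0]; exact self_mem_nhdsWithin
      · exact (isOpen_ne.eventually_mem h0).filter_mono nhdsWithin_le_nhds
    filter_upwards [hw, (hl.eventually hx).filter_mono nhdsWithin_le_nhds] with w h1 h2
    exact h2 h1
  exact tendsto_nhds_unique (hc.tendsto.mono_left nhdsWithin_le_nhds)
    (tendsto_const_nhds.congr' (h1.mono fun _ ht => ht.symm))

theorem eventuallyEq_zero_of_dirDeriv {F : ℂ × ℂ → ℂ} (hF : AnalyticAt ℂ F 0)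
    (h : ∀ᶠ x : ℂ × ℂ in 𝓝 0, x.2 ≠ 0 → dirDeriv (1, 0) F x = 0)
    (h0 : ∀ᶠ w in 𝓝 (0 : ℂ), F (0, w) = 0) : F =ᶠ[𝓝 0] fun _ => 0 := by
  refine eventuallyEq_zero_of_ne hF ?_
  obtain ⟨r, hr, hball⟩ := Metric.eventually_nhds_iff_ball.1 (h.and hF.eventually_analyticAt)
  have h0' : ∀ᶠ x : ℂ × ℂ in 𝓝 0, F (0, x.2) = 0 :=
    -- In the sup norm a ball is a product of discs. Thus `F` is constant along each connected
    -- horizontal slice `w = const ≠ 0`, which meets the axis.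
    (continuous_snd.tendsto' (0 : ℂ × ℂ) 0 rfl).eventually h0
  filter_upwards [h0', Metric.ball_mem_nhds (0 : ℂ × ℂ) hr] with x hx hxr hx0
  rw [← Prod.mk_zero_zero, ← ball_prod_same] at hball hxr
  have hd : ∀ z ∈ Metric.ball (0 : ℂ) r, HasDerivAt (fun s => F (s, x.2)) 0 z := by
    intro z hz
    obtain ⟨h1, h2⟩ := hball (z, x.2) ⟨hz, hxr.2⟩
    rw [← h1 hx0]
    exact hasDerivAt_left h2
  have := Metric.isOpen_ball.is_const_of_fderiv_eq_zero (𝕜 := ℂ) Metric.isPreconnected_ball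
    (fun z hz => (hd z hz).differentiableAt.differentiableWithinAt)
    (fun z hz => by simpa using (hd z hz).hasFDerivAt.fderiv) hxr.1 (Metric.mem_ball_self hr)
  exact this.trans hx

/-- The axis coefficients of `w'' = w ^ m Φ (z, w, w' / w ^ m)`. -/
noncomputable def axisCoefficients (Φ : ℂ × ℂ × ℂ → ℂ) : AxisCoefficients where
  f0 w := zetaCoeff Φ 2 (0, w)
  f1 w := dirDeriv (1, 0) (zetaCoeff Φ 2) (0, w)
  f2 w := dirDeriv (1, 0) (dirDeriv (1, 0) (zetaCoeff Φ 2)) (0, w)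
  f0w w := dirDeriv (0, 1) (zetaCoeff Φ 2) (0, w)
  f1w w := dirDeriv (1, 0) (dirDeriv (0, 1) (zetaCoeff Φ 2)) (0, w)
  g0 w := zetaCoeff Φ 3 (0, w)
  g1 w := dirDeriv (1, 0) (zetaCoeff Φ 3) (0, w)
  g2 w := dirDeriv (1, 0) (dirDeriv (1, 0) (zetaCoeff Φ 3)) (0, w)
  g0w w := dirDeriv (0, 1) (zetaCoeff Φ 3) (0, w)
  g1w w := dirDeriv (1, 0) (dirDeriv (0, 1) (zetaCoeff Φ 3)) (0, w)
  h0 w := zetaCoeff Φ 4 (0, w)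
  h1 w := dirDeriv (1, 0) (zetaCoeff Φ 4) (0, w)

theorem analyticAt_axis {F : ℂ × ℂ → ℂ} (hF : AnalyticAt ℂ F 0) :
    AnalyticAt ℂ (fun w => F (0, w)) 0 :=
  AnalyticAt.fun_comp (f := fun w : ℂ => ((0, w) : ℂ × ℂ)) hF
    (analyticAt_const.prod analyticAt_id)

theorem axisCoefficients_regular {Φ : ℂ × ℂ × ℂ → ℂ} (hΦ : AnalyticAt ℂ Φ 0) :
    (axisCoefficients Φ).Regular := by
  have h : ∀ k, AnalyticAt ℂ (zetaCoeff Φ k) 0 := fun k => analyticAt_zetaCoeff (x := 0) hΦ k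
  have h' : ∀ k v, AnalyticAt ℂ (dirDeriv v (zetaCoeff Φ k)) 0 :=
    fun k v => analyticAt_dirDeriv (h k) v
  have h'' : ∀ k v v', AnalyticAt ℂ (dirDeriv v (dirDeriv v' (zetaCoeff Φ k))) 0 :=
    fun k v v' => analyticAt_dirDeriv (h' k v') v
  constructor
  · exact analyticAt_axis (h 2)
  · exact (analyticAt_axis (h' 2 _)).continuousAt
  · exact (analyticAt_axis (h'' 2 _ _)).continuousAt
  · exact (analyticAt_axis (h' 2 _)).continuousAt
  · exact (analyticAt_axis (h'' 2 _ _)).continuousAt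
  · exact (analyticAt_axis (h 3)).continuousAt
  · exact (analyticAt_axis (h' 3 _)).continuousAt
  · exact (analyticAt_axis (h'' 3 _ _)).continuousAt
  · exact (analyticAt_axis (h' 3 _)).continuousAt
  · exact (analyticAt_axis (h'' 3 _ _)).continuousAt
  · exact (analyticAt_axis (h 4)).continuousAt
  · exact (analyticAt_axis (h' 4 _)).continuousAt

/-- The four equations are the rows of the resonance matrix applied to `(A, B, U, V)`. The second
`z`-derivatives `f2`, `g2` are twice the Taylor coefficients, hence the entries `2 α₂`, `2 β₂`. -/
theorem axisCoefficients_nonResonant {Φ : ℂ × ℂ × ℂ → ℂ} (hΦ : AnalyticAt ℂ Φ 0)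
    (hres : IsUnit (resonanceMatrix Φ)) (A B U V : ℂ)
    (h1 : U * (axisCoefficients Φ).f1 0 + A * (axisCoefficients Φ).f0 0
      + 3 * (axisCoefficients Φ).g0 0 * B = 0)
    (h2 : V * (axisCoefficients Φ).f1 0 + U * (axisCoefficients Φ).f2 0
      + A * (axisCoefficients Φ).f1 0 + 3 * (axisCoefficients Φ).g1 0 * B = 0)
    (h3 : U * (axisCoefficients Φ).g1 0 + 2 * A * (axisCoefficients Φ).g0 0
      + 4 * (axisCoefficients Φ).h0 0 * B - V * (axisCoefficients Φ).g0 0 = 0)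
    (h4 : U * (axisCoefficients Φ).g2 0 + 2 * A * (axisCoefficients Φ).g1 0
      + 4 * (axisCoefficients Φ).h1 0 * B
      + 2 * (axisCoefficients Φ).f0 0 * B * (axisCoefficients Φ).g0 0 = 0) :
    A = 0 ∧ B = 0 ∧ U = 0 ∧ V = 0 := by
  have c0 : ∀ k, zetaCoeff Φ k (0, 0) = coeffAt Φ 0 k := fun k => by
    simp [coeffAt_eq hΦ, Prod.mk_zero_zero]
  have c1 : ∀ k, dirDeriv (1, 0) (zetaCoeff Φ k) (0, 0) = coeffAt Φ 1 k := fun k => by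
    simp [coeffAt_eq hΦ, Prod.mk_zero_zero]
  have c2 : ∀ k, dirDeriv (1, 0) (dirDeriv (1, 0) (zetaCoeff Φ k)) (0, 0) = 2 * coeffAt Φ 2 k :=
    fun k => by
      rw [coeffAt_eq hΦ]
      simp only [Function.iterate_succ, Function.iterate_zero, Function.comp_apply, id,
        Nat.factorial_two, Nat.cast_ofNat, Prod.mk_zero_zero]
      ring
  simp only [axisCoefficients, c0, c1, c2] at h1 h2 h3 h4
  have hinj := Matrix.mulVec_injective_iff_isUnit.2 hres
  have h0 : (resonanceMatrix Φ).mulVec ![A, B, U, V] = (resonanceMatrix Φ).mulVec 0 := by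
    rw [Matrix.mulVec_zero]
    ext i
    fin_cases i <;>
      simp only [resonanceMatrix, Matrix.mulVec, dotProduct, Fin.sum_univ_four] <;> simp
    · linear_combination h1
    · linear_combination h2
    · linear_combination h3
    · linear_combination h4
  have hv := hinj h0
  exact ⟨congrFun hv 0, congrFun hv 1, congrFun hv 2, congrFun hv 3⟩

/-- The coefficient equations hold near each axis point with `w ≠ 0`, so those of `ζ ^ 2` and `ζ ^
3` may also be differentiated in `z`. This gives `e2'` and `e3'`, once `Q_zz = 0` is used. -/
theorem DeterminingEquation.axisSystem {m : ℕ} {Φ : ℂ × ℂ × ℂ → ℂ} {P Q : ℂ × ℂ → ℂ}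
    (hΦ : AnalyticAt ℂ Φ 0)
    (h2 : ∀ᶠ q : ℂ × ℂ in 𝓝 0, Φ (q.1, q.2, 0) = 0 ∧ deriv (fun ζ => Φ (q.1, q.2, ζ)) 0 = 0)
    (hP : AnalyticAt ℂ P 0) (hQ : AnalyticAt ℂ Q 0)
    (hDE : ∀ᶠ q : ℂ × ℂ × ℂ in 𝓝 0, q.2.1 ≠ 0 → DeterminingEquation m Φ P Q q) :
    ∀ᶠ w in 𝓝[≠] (0 : ℂ), AxisSystem m (axisCoefficients Φ)
      (fun w => Q (0, w)) (fun w => dirDeriv (1, 0) Q (0, w)) (fun w => P (0, w))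
      (fun w => dirDeriv (1, 0) P (0, w))
      (fun w => dirDeriv (1, 0) (dirDeriv (1, 0) P) (0, w)) w := by
  have hc := DeterminingEquation.coefficients hΦ h2 hDE
  have hφ : ∀ k, AnalyticAt ℂ (zetaCoeff Φ k) 0 := fun k => analyticAt_zetaCoeff (x := 0) hΦ k
  have hne : ∀ᶠ w : ℂ in 𝓝[≠] 0, w ≠ 0 := self_mem_nhdsWithin
  have hall := eventually_axis (hc.eventually_nhds.and
    (hP.eventually_analyticAt.and (hQ.eventually_analyticAt.and
    ((hφ 2).eventually_analyticAt.and ((hφ 3).eventually_analyticAt.and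
    (hφ 4).eventually_analyticAt)))))
  have hder : ∀ {F : ℂ × ℂ → ℂ}, (∀ᶠ w in 𝓝 (0 : ℂ), AnalyticAt ℂ F (0, w)) →
      ∀ᶠ w in 𝓝 (0 : ℂ), deriv (fun w => F (0, w)) w = dirDeriv (0, 1) F (0, w) := by
    intro F hF
    filter_upwards [hF] with w hw
    exact (hasDerivAt_right hw).deriv
  have hder2 : ∀ {F : ℂ × ℂ → ℂ}, (∀ᶠ w in 𝓝 (0 : ℂ), AnalyticAt ℂ F (0, w)) →
      ∀ᶠ w in 𝓝 (0 : ℂ), deriv (deriv (fun w => F (0, w))) w =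
        dirDeriv (0, 1) (dirDeriv (0, 1) F) (0, w) := by
    intro F hF
    filter_upwards [hF, (hder hF).eventually_nhds] with w hw hw2
    rw [EventuallyEq.deriv_eq hw2]
    exact (hasDerivAt_right (analyticAt_dirDeriv hw _)).deriv
  have aP : ∀ᶠ w in 𝓝 (0 : ℂ), AnalyticAt ℂ P (0, w) := hall.mono fun w h => h.2.1
  have aQ : ∀ᶠ w in 𝓝 (0 : ℂ), AnalyticAt ℂ Q (0, w) := hall.mono fun w h => h.2.2.1
  have aPz := aP.mono fun w h => analyticAt_dirDeriv h (1, 0)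
  have aQz := aQ.mono fun w h => analyticAt_dirDeriv h (1, 0)
  have aPzz := aPz.mono fun w h => analyticAt_dirDeriv h (1, 0)
  filter_upwards [hall.filter_mono nhdsWithin_le_nhds, hne,
    (hder aP).filter_mono nhdsWithin_le_nhds, (hder aQ).filter_mono nhdsWithin_le_nhds,
    (hder aPz).filter_mono nhdsWithin_le_nhds, (hder aQz).filter_mono nhdsWithin_le_nhds,
    (hder aPzz).filter_mono nhdsWithin_le_nhds,
    (hder2 aP).filter_mono nhdsWithin_le_nhds, (hder2 aQ).filter_mono nhdsWithin_le_nhds,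
    (hder2 aPz).filter_mono nhdsWithin_le_nhds, (hder2 aQz).filter_mono nhdsWithin_le_nhds]
    with w ⟨hcw, hPw, hQw, hφ2, hφ3, hφ4⟩ hw dP dQ dPz dQz dPzz ddP ddQ ddPz ddQz
  have hl : ContinuousAt (fun z : ℂ => ((z, w) : ℂ × ℂ)) 0 := by fun_prop
  have hcz := hl.eventually hcw
  -- mixed derivatives along the axis
  have sw : ∀ {F : ℂ × ℂ → ℂ}, AnalyticAt ℂ F (0, w) →
      dirDeriv (1, 0) (dirDeriv (0, 1) F) (0, w) = dirDeriv (0, 1) (dirDeriv (1, 0) F) (0, w) :=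
    fun hF => dirDeriv_comm hF _ _
  have sww : ∀ {F : ℂ × ℂ → ℂ}, AnalyticAt ℂ F (0, w) →
      dirDeriv (1, 0) (dirDeriv (0, 1) (dirDeriv (0, 1) F)) (0, w) =
        dirDeriv (0, 1) (dirDeriv (0, 1) (dirDeriv (1, 0) F)) (0, w) := by
    intro F hF
    rw [sw (analyticAt_dirDeriv hF _)]
    refine (dirDeriv_congr ?_ _).self_of_nhds
    filter_upwards [hF.eventually_analyticAt] with x hx
    exact dirDeriv_comm hx _ _
  have hQzz : dirDeriv (1, 0) (dirDeriv (1, 0) Q) (0, w) = 0 := (hcz.self_of_nhds hw).1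
  have L : ∀ {F : ℂ × ℂ → ℂ}, AnalyticAt ℂ F (0, w) →
      HasDerivAt (fun z => F (z, w)) (dirDeriv (1, 0) F (0, w)) 0 := fun hF => hasDerivAt_left hF
  have A : ∀ {F : ℂ × ℂ → ℂ} (v : ℂ × ℂ), AnalyticAt ℂ F (0, w) →
      AnalyticAt ℂ (dirDeriv v F) (0, w) := fun v hF => analyticAt_dirDeriv hF v
  obtain ⟨-, k1, k2, k3⟩ := hcz.self_of_nhds hw
  constructor
  · rw [dQz]
    exact k1
  · rw [dPz, ddQ, dQ]
    exact k2
  -- The `z`-derivatives at `z = 0` of the two sides of the `ζ ^ 2` equation; uniqueness of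
  -- derivatives equates them.
  · have dl := (((L (A (0, 1) (A (0, 1) hQw))).sub
      ((L (A (0, 1) (A (1, 0) hPw))).const_mul 2)).const_mul ((w ^ m) ^ 2))
    have dr := ((((L hPw).mul (L (A (1, 0) hφ2))).const_mul (w ^ m)).add
      ((L hQw).mul (((L (A (0, 1) hφ2)).const_mul (w ^ m)).sub
        ((L hφ2).const_mul (m * w ^ (m - 1)))))).add
      (((L hφ3).const_mul 3).mul (L (A (1, 0) hQw))) |>.add
      (((L (A (0, 1) hQw)).const_mul (w ^ m)).mul (L hφ2))
    have he := dl.unique (dr.congr_of_eventuallyEq (hcz.mono fun z hz => (hz hw).2.2.1))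
    rw [dPzz, ddQz, dQz, dQ, ← sww hQw, ← sw hQw, ← sw (A _ hPw)]
    simp only [axisCoefficients]
    rw [hQzz] at he
    simp only [Pi.sub_apply] at he
    linear_combination he
  · rw [ddP, dP, dQ]
    exact k3
  · have dl := ((L (A (0, 1) (A (0, 1) hPw))).const_mul ((w ^ m) ^ 3)).neg.sub
      (((L (A (0, 1) hPw)).const_mul ((w ^ m) ^ 2)).mul (L hφ2))
    have dr := ((((L hPw).mul (L (A (1, 0) hφ3))).const_mul (w ^ m)).add
      ((L hQw).mul (((L (A (0, 1) hφ3)).const_mul (w ^ m)).sub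
        ((L hφ3).const_mul (2 * m * w ^ (m - 1)))))).add
      (((L hφ4).const_mul 4).mul (L (A (1, 0) hQw))) |>.add
      (((((L (A (0, 1) hQw)).const_mul 2).sub (L (A (1, 0) hPw))).const_mul (w ^ m)).mul (L hφ3))
    have he := dl.unique (dr.congr_of_eventuallyEq (hcz.mono fun z hz => (hz hw).2.2.2))
    rw [ddPz, dPz, dP, dQz, dQ, ← sww hPw, ← sw hPw, ← sw hQw]
    simp only [axisCoefficients]
    rw [hQzz] at he
    simp only [Pi.sub_apply] at he
    linear_combination he

end Uniqueness
-- Vanishing of a symmetry with zero jet.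
section Uniqueness

/-- A symmetry of a non-resonant equation vanishes if the coefficient of `w ^ m` of `Q (0, w)`
does. The hypothesis `hbd` says that the prolonged vector field is regular along `w = 0`. -/
theorem DeterminingEquation.eventually_eq_zero {m : ℕ} (hm : 2 ≤ m) {Φ : ℂ × ℂ × ℂ → ℂ}
    {P Q : ℂ × ℂ → ℂ} (hΦ : AnalyticAt ℂ Φ 0)
    (h2 : ∀ᶠ q : ℂ × ℂ in 𝓝 0, Φ (q.1, q.2, 0) = 0 ∧ deriv (fun ζ => Φ (q.1, q.2, ζ)) 0 = 0)
    (hres : IsUnit (resonanceMatrix Φ))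
    (hP : AnalyticAt ℂ P 0) (hQ : AnalyticAt ℂ Q 0)
    (hDE : ∀ᶠ q : ℂ × ℂ × ℂ in 𝓝 0, q.2.1 ≠ 0 → DeterminingEquation m Φ P Q q)
    {C : ℝ}
    (hbd : ∀ᶠ q : ℂ × ℂ × ℂ in 𝓝 0, ‖dirDeriv (1, 0) Q (q.1, q.2.1)
      + (dirDeriv (0, 1) Q (q.1, q.2.1) - dirDeriv (1, 0) P (q.1, q.2.1)) * (q.2.1 ^ m * q.2.2)
      - dirDeriv (0, 1) P (q.1, q.2.1) * (q.2.1 ^ m * q.2.2) ^ 2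
      - m * q.2.1 ^ (m - 1) * Q (q.1, q.2.1) * q.2.2‖ ≤ C * ‖q.2.1‖ ^ m)
    (hjet : iteratedDeriv m (fun w => Q (0, w)) 0 = 0) :
    (P =ᶠ[𝓝 0] fun _ => 0) ∧ (Q =ᶠ[𝓝 0] fun _ => 0) := by
  have hQz := analyticAt_dirDeriv hQ (1, 0)
  have hPz := analyticAt_dirDeriv hP (1, 0)
  -- The slope `t` is quantified first, so that it can be held fixed while `w → 0`.
  have cur : ∀ᶠ t in 𝓝 (0 : ℂ), ∀ᶠ w in 𝓝 (0 : ℂ), ‖dirDeriv (1, 0) Q (0, w)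
      + (dirDeriv (0, 1) Q (0, w) - dirDeriv (1, 0) P (0, w)) * (w ^ m * t)
      - dirDeriv (0, 1) P (0, w) * (w ^ m * t) ^ 2
      - m * w ^ (m - 1) * Q (0, w) * t‖ ≤ C * ‖w‖ ^ m := by
    have hc : ContinuousAt (fun y : ℂ × ℂ => ((0, y.2, y.1) : ℂ × ℂ × ℂ)) (0, 0) := by fun_prop
    exact (hc.eventually hbd).curry_nhds
  -- At `t = 0` only `Q_z` survives in the bound.
  have hb0 : (m : ℕ∞) ≤ analyticOrderAt (fun w => dirDeriv (1, 0) Q (0, w)) 0 := by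
    refine le_analyticOrderAt_of_norm_le (C := C) (analyticAt_axis hQz) ?_
    filter_upwards [cur.self_of_nhds] with w hw
    simpa using hw
  have ha0 : Q (0, 0) = 0 := by
    obtain ⟨t, ht, ht0⟩ := ((cur.filter_mono nhdsWithin_le_nhds).and
      (self_mem_nhdsWithin : ∀ᶠ t : ℂ in 𝓝[≠] 0, t ≠ 0)).exists
    obtain ⟨B, hB, hbB⟩ := exists_eq_pow_mul (analyticAt_axis hQz) hb0
    have a1 := analyticAt_axis hQ
    have a2 := analyticAt_axis (analyticAt_dirDeriv hQ (0, 1))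
    have a3 := analyticAt_axis hPz
    have a4 := analyticAt_axis (analyticAt_dirDeriv hP (0, 1))
    have a5 := analyticAt_axis hQz
    have hG := le_analyticOrderAt_of_norm_le (by fun_prop) ht
    obtain ⟨G, hGa, hGe⟩ := exists_eq_pow_mul (by fun_prop) hG
    have c1 := a1.continuousAt
    have c2 := a2.continuousAt
    have c3 := a3.continuousAt
    have c4 := a4.continuousAt
    have cB := hB.continuousAt
    have cG := hGa.continuousAt
    -- At a fixed `t ≠ 0` the bounded expression is `w ^ m G`. Dividing by `w ^ (m - 1)` shows that
    -- `m t Q (0, w)` is `w` times a continuous function.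
    have h0 := eq_zero_of_punctured (G := fun w => m * t * Q (0, w) - w * (B w
      + (dirDeriv (0, 1) Q (0, w) - dirDeriv (1, 0) P (0, w)) * t
      - dirDeriv (0, 1) P (0, w) * w ^ m * t ^ 2 - G w)) (by fun_prop) (by
        filter_upwards [hbB.filter_mono nhdsWithin_le_nhds, hGe.filter_mono nhdsWithin_le_nhds,
          (self_mem_nhdsWithin : ∀ᶠ t : ℂ in 𝓝[≠] 0, t ≠ 0)] with w h1 h2 hw
        refine mul_left_cancel₀ (pow_ne_zero (m - 1) hw) ?_
        have hp : w ^ m = w ^ (m - 1) * w := by rw [← pow_succ, Nat.sub_add_cancel (by omega)]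
        rw [h1, hp] at h2
        rw [hp]
        linear_combination -h2)
    have hm0 : (m : ℂ) ≠ 0 := by exact_mod_cast (show m ≠ 0 by omega)
    simp only [zero_mul, sub_zero] at h0
    exact (mul_eq_zero.1 h0).resolve_left (mul_ne_zero hm0 ht0)
  have hzero := AxisSystem.eq_zero hm (axisCoefficients_regular hΦ)
    (axisCoefficients_nonResonant hΦ hres) (analyticAt_axis hQ) (analyticAt_axis hQz)
    (analyticAt_axis hP) (analyticAt_axis hPz) ha0 hb0 hjet
    (DeterminingEquation.axisSystem hΦ h2 hP hQ hDE)
  have hcoef := DeterminingEquation.coefficients hΦ h2 hDE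
  have hd0 : ∀ (v x : ℂ × ℂ), dirDeriv v (fun _ => (0 : ℂ)) x = 0 := fun v x => by simp [dirDeriv]
  have z1 := eventuallyEq_zero_of_dirDeriv hQz (hcoef.mono fun x h hx => (h hx).1)
    (hzero.mono fun w h => h.2.1)
  have z2 := eventuallyEq_zero_of_dirDeriv hQ (z1.mono fun x h _ => h)
    (hzero.mono fun w h => h.1)
  -- Once `Q_z = 0`, the `ζ ^ 1` equation becomes `w ^ m P_zz = 0`.
  have z3 : dirDeriv (1, 0) P =ᶠ[𝓝 0] fun _ => 0 := by
    refine eventuallyEq_zero_of_dirDeriv hPz ?_ (hzero.mono fun w h => h.2.2.2)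
    filter_upwards [hcoef, z1, dirDeriv_congr z1 (0, 1)] with x hx h1 h3 hx0
    obtain ⟨-, e, -⟩ := hx hx0
    rw [h1, h3, hd0] at e
    simpa [hx0] using e
  exact ⟨eventuallyEq_zero_of_dirDeriv hP (z3.mono fun x h _ => h)
    (hzero.mono fun w h => h.2.2.1), z2⟩

end Uniqueness
-- The Segre family in the coordinates `(z, w, ζ)`.
section SegreFamily

theorem fderiv_pair (F : ℂ × ℂ → ℂ) (x : ℂ × ℂ) (a b : ℂ) :
    fderiv ℂ F x (a, b) = a * dirDeriv (1, 0) F x + b * dirDeriv (0, 1) F x := by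
  have h : ((a, b) : ℂ × ℂ) = a • (1, 0) + b • (0, 1) := by simp
  rw [h, map_add, map_smul, map_smul]
  rfl

theorem fderiv_triple (F : ℂ × ℂ × ℂ → ℂ) (x : ℂ × ℂ × ℂ) (a b c : ℂ) :
    fderiv ℂ F x (a, b, c) =
      a * dirDeriv (1, 0, 0) F x + b * dirDeriv (0, 1, 0) F x + c * dirDeriv (0, 0, 1) F x := by
  have h : ((a, b, c) : ℂ × ℂ × ℂ) = a • (1, 0, 0) + b • (0, 1, 0) + c • (0, 0, 1) := by simp
  rw [h, map_add, map_add, map_smul, map_smul, map_smul]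
  rfl

theorem hasDerivAt_line_zero {E : Type*} [NormedAddCommGroup E] [NormedSpace ℂ E]
    {F : E → ℂ} {q : E} (v : E) (hF : AnalyticAt ℂ F q) :
    HasDerivAt (fun t : ℂ => F (q + t • v)) (dirDeriv v F q) 0 := by
  simpa using hasDerivAt_line (F := F) (c := q) (v := v) (t := 0) (by simpa using hF)

/-- The slope of the Segre varieties, divided by `w ^ m`, is holomorphic, and together with the
point it gives local coordinates on the Segre family. -/
theorem IsComplexDefiningFunction.exists_slope {m : ℕ} (hm : 2 ≤ m) {ε : ℝ} (hε : ε ≠ 0)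
    {R Θ : ℂ × ℂ × ℂ → ℂ} (hR : AnalyticAt ℂ R 0)
    (hΘ : IsComplexDefiningFunction (admissibleFunction m ε R) Θ) :
    ∃ g : ℂ × ℂ × ℂ → ℂ, AnalyticAt ℂ g 0 ∧
      (∀ᶠ q in 𝓝 0, dirDeriv (1, 0, 0) Θ q = Θ q ^ m * g q) ∧
      (∀ᶠ q : ℂ × ℂ × ℂ in 𝓝 0, Θ q = 0 ↔ q.2.2 = 0) ∧
      g 0 = 0 ∧ map (fun q => (q.1, Θ q, g q)) (𝓝 0) = 𝓝 0 := by
  obtain ⟨hΘa, hΘ0, hΘe⟩ := hΘ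
  have p1 : ∀ q : ℂ × ℂ × ℂ, AnalyticAt ℂ (fun q : ℂ × ℂ × ℂ => q.1) q := fun q => analyticAt_fst
  have p2 : ∀ q : ℂ × ℂ × ℂ, AnalyticAt ℂ (fun q : ℂ × ℂ × ℂ => q.2.1) q :=
    fun q => analyticAt_fst.comp analyticAt_snd
  have p3 : ∀ q : ℂ × ℂ × ℂ, AnalyticAt ℂ (fun q : ℂ × ℂ × ℂ => q.2.2) q :=
    fun q => analyticAt_snd.comp analyticAt_snd
  set u : ℂ × ℂ × ℂ → ℂ := fun q => (Θ q + q.2.2) / 2 with hu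
  have hua : ∀ {q}, AnalyticAt ℂ Θ q → AnalyticAt ℂ u q := fun h => (h.add (p3 _)).div_const
  have hu0 : u 0 = 0 := by simp [hu, hΘ0]
  set σ : ℂ × ℂ × ℂ → ℂ × ℂ × ℂ := fun q => (q.1, q.2.1, u q) with hσ
  have hσa : ∀ {q}, AnalyticAt ℂ Θ q → AnalyticAt ℂ σ q :=
    fun h => (p1 _).prod ((p2 _).prod (hua h))
  have hσ0 : σ 0 = 0 := by simp [hσ, hu0]
  have comp : ∀ {F : ℂ × ℂ × ℂ → ℂ}, AnalyticAt ℂ F 0 → AnalyticAt ℂ (fun q => F (σ q)) 0 :=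
    fun hF => AnalyticAt.fun_comp (f := σ) (by rwa [hσ0]) (hσa hΘa)
  have a1 := comp hR
  have a2 := comp (analyticAt_dirDeriv hR (1, 0, 0))
  have a3 := comp (analyticAt_dirDeriv hR (0, 0, 1))
  have a4 := hua hΘa
  have b1 := p1 0
  have b2 := p2 0
  set S : ℂ × ℂ × ℂ → ℂ := fun q => ε * q.1 * q.2.1 + q.1 ^ 2 * q.2.1 ^ 2 * R (σ q) with hS
  have hSa : AnalyticAt ℂ S 0 :=
    ((analyticAt_const.mul b1).mul b2).add (((b1.pow 2).mul (b2.pow 2)).mul a1)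
  have hS0 : S 0 = 0 := by simp [hS]
  set Sz : ℂ × ℂ × ℂ → ℂ := fun q => ε * q.2.1 + 2 * q.1 * q.2.1 ^ 2 * R (σ q)
    + q.1 ^ 2 * q.2.1 ^ 2 * dirDeriv (1, 0, 0) R (σ q) with hSz
  have hSza : AnalyticAt ℂ Sz 0 :=
    ((analyticAt_const.mul b2).add (((analyticAt_const.mul b1).mul (b2.pow 2)).mul a1)).add
      (((b1.pow 2).mul (b2.pow 2)).mul a2)
  -- With `u = (Θ + τ) / 2`, the defining equation is `Θ = τ + i u ^ m S`. Differentiating it in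
  -- `z`, with `u_z = Θ_z / 2`, and collecting `Θ_z` gives `Θ_z D = i u ^ m S_z`.
  set D : ℂ × ℂ × ℂ → ℂ := fun q => 1 - Complex.I / 2 * (m * u q ^ (m - 1) * S q
    + u q ^ m * (q.1 ^ 2 * q.2.1 ^ 2 * dirDeriv (0, 0, 1) R (σ q))) with hD
  have hDa : AnalyticAt ℂ D 0 := by fun_prop
  have hD0 : D 0 = 1 := by simp [hD, hS0]
  -- The units in `Θ = u E` and `τ = u E'`. They show that `Θ`, `u` and `τ` vanish together, and
  -- turn `u ^ m` into `Θ ^ m / E ^ m`.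
  set E : ℂ × ℂ × ℂ → ℂ := fun q => 1 + Complex.I / 2 * u q ^ (m - 1) * S q with hE
  have hEa : AnalyticAt ℂ E 0 := by fun_prop
  have hE0 : E 0 = 1 := by simp [hE, hS0]
  set E' : ℂ × ℂ × ℂ → ℂ := fun q => 1 - Complex.I / 2 * u q ^ (m - 1) * S q with hE'
  have hEa' : AnalyticAt ℂ E' 0 := by fun_prop
  have hE0' : E' 0 = 1 := by simp [hE', hS0]
  have neD := hDa.continuousAt.eventually_ne (y := 0) (by rw [hD0]; exact one_ne_zero)
  have neE := hEa.continuousAt.eventually_ne (y := 0) (by rw [hE0]; exact one_ne_zero)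
  have neE' := hEa'.continuousAt.eventually_ne (y := 0) (by rw [hE0']; exact one_ne_zero)
  have hpm : ∀ x : ℂ, x ^ m = x ^ (m - 1) * x := fun x => by
    rw [← pow_succ, Nat.sub_add_cancel (by omega)]
  have eqn : ∀ᶠ q : ℂ × ℂ × ℂ in 𝓝 0, Θ q = q.2.2 + Complex.I * u q ^ m * S q := by
    filter_upwards [hΘe] with q hq
    have hI : (2 * Complex.I) ≠ 0 := by simp
    rw [div_eq_iff hI] at hq
    simp only [admissibleFunction] at hq
    simp only [hS, hσ, hu]
    linear_combination hq
  have fac : ∀ᶠ q : ℂ × ℂ × ℂ in 𝓝 0, Θ q = u q * E q ∧ q.2.2 = u q * E' q := by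
    filter_upwards [eqn] with q hq
    rw [hpm] at hq
    have h2 : 2 * u q = Θ q + q.2.2 := by simp only [hu]; ring
    simp only [hE, hE']
    constructor
    · linear_combination (1 / 2 : ℂ) * hq - (1 / 2 : ℂ) * h2
    · linear_combination (-1 / 2 : ℂ) * hq - (1 / 2 : ℂ) * h2
  have slope : ∀ᶠ q in 𝓝 0, dirDeriv (1, 0, 0) Θ q * D q = Complex.I * u q ^ m * Sz q := by
    have hRσ : ∀ᶠ q in 𝓝 0, AnalyticAt ℂ R (σ q) :=
      (hσa hΘa).continuousAt.eventually (by rw [hσ0]; exact hR.eventually_analyticAt)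
    filter_upwards [eqn.eventually_nhds, hΘa.eventually_analyticAt, hRσ] with q hq ha hRq
    have hl : ContinuousAt (fun t : ℂ => q + t • ((1, 0, 0) : ℂ × ℂ × ℂ)) 0 := by fun_prop
    have hline := hl.eventually (p := fun q => Θ q = q.2.2 + Complex.I * u q ^ m * S q)
      (by simpa using hq)
    have dΘ := hasDerivAt_line_zero (1, 0, 0) ha
    have d1 : HasDerivAt (fun t : ℂ => (q + t • ((1, 0, 0) : ℂ × ℂ × ℂ)).1) 1 0 := by
      simpa using (hasDerivAt_id (0 : ℂ)).const_add q.1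
    have d2 : HasDerivAt (fun t : ℂ => (q + t • ((1, 0, 0) : ℂ × ℂ × ℂ)).2.1) 0 0 := by
      simpa using hasDerivAt_const (0 : ℂ) q.2.1
    have d3 : HasDerivAt (fun t : ℂ => (q + t • ((1, 0, 0) : ℂ × ℂ × ℂ)).2.2) 0 0 := by
      simpa using hasDerivAt_const (0 : ℂ) q.2.2
    set p := dirDeriv (1, 0, 0) Θ q
    have du : HasDerivAt (fun t : ℂ => u (q + t • ((1, 0, 0) : ℂ × ℂ × ℂ))) (p / 2) 0 := by
      simpa [hu] using (dΘ.add d3).div_const 2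
    have dσ := d1.prodMk (d2.prodMk du)
    have dR := HasFDerivAt.comp_hasDerivAt (f := fun t : ℂ => σ (q + t • ((1, 0, 0) : ℂ × ℂ × ℂ)))
      (l := R) (l' := fderiv ℂ R (σ q)) 0 (by simpa using hRq.differentiableAt.hasFDerivAt) dσ
    rw [fderiv_triple] at dR
    have dS := (((d1.const_mul (ε : ℂ)).mul d2)).add (((d1.pow 2).mul (d2.pow 2)).mul dR)
    have dr := d3.add (((du.pow m).const_mul Complex.I).mul dS)
    have he := dΘ.unique (dr.congr_of_eventuallyEq hline)
    simp only [zero_smul, add_zero, Pi.mul_apply, Pi.add_apply, Pi.pow_apply,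
      Function.comp_apply] at he
    simp only [hD, hSz, hS]
    push_cast at he
    simp only [pow_one] at he
    linear_combination he
  have hg : AnalyticAt ℂ (fun q => Complex.I * Sz q / (D q * E q ^ m)) 0 := by
    refine (analyticAt_const.mul hSza).div (hDa.mul (hEa.pow m)) ?_
    simp [hD0, hE0]
  refine ⟨fun q => Complex.I * Sz q / (D q * E q ^ m), hg, ?_, ?_, by simp [hSz], ?_⟩
  · filter_upwards [slope, fac, neD, neE] with q h1 h2 h3 h4
    rw [h2.1, mul_pow]
    field_simp
    linear_combination h1
  · filter_upwards [fac, neE, neE'] with q h1 h2 h3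
    rw [h1.1, h1.2]
    simp [h2, h3]
  · have hGa : AnalyticAt ℂ (fun q => (q.1, Θ q, Complex.I * Sz q / (D q * E q ^ m))) 0 :=
      b1.prod (hΘa.prod hg)
    have key := hGa.hasStrictFDerivAt
    set L := fderiv ℂ (fun q => (q.1, Θ q, Complex.I * Sz q / (D q * E q ^ m))) 0 with hL
    have line : ∀ v : ℂ × ℂ × ℂ, HasDerivAt (fun t : ℂ => (((t • v).1, Θ (t • v),
        Complex.I * Sz (t • v) / (D (t • v) * E (t • v) ^ m)) : ℂ × ℂ × ℂ)) (L v) 0 := by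
      intro v
      have hv : HasDerivAt (fun t : ℂ => t • v) v 0 := by
        simpa using (hasDerivAt_id (0 : ℂ)).smul_const v
      exact HasFDerivAt.comp_hasDerivAt (f := fun t : ℂ => t • v)
        (l := fun q => (q.1, Θ q, Complex.I * Sz q / (D q * E q ^ m))) 0
        (by simpa using key.hasFDerivAt) hv
    have cl : ∀ v : ℂ × ℂ × ℂ, Tendsto (fun t : ℂ => t • v) (𝓝 0) (𝓝 0) := fun v =>
      Continuous.tendsto' (by fun_prop) _ _ (by simp)
    -- The differential of `(z, Θ, g)` at `0` is found along the axes: `τ` moves only `w`, `χ` moves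
    -- only `ζ`, with speed `i ε ≠ 0`, and `z` moves its own component with speed 1. Hence it is
    -- onto.
    have L3 : L (0, 0, 1) = (0, 1, 0) := by
      have hd : HasDerivAt (fun t : ℂ => ((0, t, 0) : ℂ × ℂ × ℂ)) (0, 1, 0) 0 :=
        (hasDerivAt_const _ _).prodMk ((hasDerivAt_id _).prodMk (hasDerivAt_const _ _))
      refine (line (0, 0, 1)).unique (hd.congr_of_eventuallyEq ?_)
      filter_upwards [(cl (0, 0, 1)).eventually eqn] with t ht
      simpa [hS, hSz] using ht
    have L2 : L (0, 1, 0) = (0, 0, Complex.I * ε) := by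
      have hd : HasDerivAt (fun t : ℂ => ((0, 0, Complex.I * ε * t) : ℂ × ℂ × ℂ))
          (0, 0, Complex.I * ε) 0 :=
        (hasDerivAt_const _ _).prodMk ((hasDerivAt_const _ _).prodMk
          (by simpa using (hasDerivAt_id (0 : ℂ)).const_mul (Complex.I * ε)))
      refine (line (0, 1, 0)).unique (hd.congr_of_eventuallyEq ?_)
      filter_upwards [(cl (0, 1, 0)).eventually eqn] with t ht
      have ht' : Θ (0, t, 0) = 0 := by simpa [hS] using ht
      simp [hS, hSz, hD, hE, ht', mul_assoc]
    have L1 : (L (1, 0, 0)).1 = 1 := by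
      have h1 := (ContinuousLinearMap.fst ℂ ℂ (ℂ × ℂ)).hasFDerivAt.comp_hasDerivAt 0
        (line (1, 0, 0))
      have h2 : HasDerivAt (fun t : ℂ => (t • ((1, 0, 0) : ℂ × ℂ × ℂ)).1) 1 0 := by
        simpa using hasDerivAt_id' (0 : ℂ)
      exact h1.unique h2
    have hsurj : (L : (ℂ × ℂ × ℂ) →L[ℂ] (ℂ × ℂ × ℂ)).range = ⊤ := by
      rw [LinearMap.range_eq_top]
      rintro ⟨a, b, c⟩
      have hIε : Complex.I * (ε : ℂ) ≠ 0 := by simp [hε]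
      refine ⟨a • (1, 0, 0) + ((c - a * (L (1, 0, 0)).2.2) / (Complex.I * ε)) • (0, 1, 0)
        + (b - a * (L (1, 0, 0)).2.1) • (0, 0, 1), ?_⟩
      simp only [ContinuousLinearMap.coe_coe, map_add, map_smul, L2, L3]
      refine Prod.ext ?_ (Prod.ext ?_ ?_)
      · simp [L1]
      · simp
      · simp only [Prod.snd_add, Prod.smul_snd, smul_eq_mul, mul_zero, add_zero,
          div_mul_cancel₀ _ hIε]
        ring
    have := key.map_nhds_eq_of_surj hsurj
    rw [this]
    congr 1
    simp [hSz, hΘ0]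

end SegreFamily
-- Prolongation of the symmetry to the slope and to the second derivative.
section Prolongation

/-- Exchange of a vector field `v` with a constant direction `e`: if `v F = K` near `q`, then
`v (e F) = e K - (e v) F`. -/
theorem fderiv_dirDeriv_of_fderiv_eq {E : Type*} [NormedAddCommGroup E] [NormedSpace ℂ E]
    {F K : E → ℂ} {v : E → E} {q e v' : E} {k : ℂ} (hF : AnalyticAt ℂ F q)
    (hFK : ∀ᶠ x in 𝓝 q, fderiv ℂ F x (v x) = K x)
    (hv : HasDerivAt (fun t : ℂ => v (q + t • e)) v' 0)
    (hK : HasDerivAt (fun t : ℂ => K (q + t • e)) k 0) :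
    fderiv ℂ (dirDeriv e F) q (v q) = k - fderiv ℂ F q v' := by
  have hs : IsSymmSndFDerivAt ℂ F q :=
    (hF.contDiffAt (n := 2)).isSymmSndFDerivAt (by simp)
  have hl : HasDerivAt (fun t : ℂ => q + t • e) e 0 := by
    simpa using ((hasDerivAt_id (0 : ℂ)).smul_const e).const_add q
  have hlc : Tendsto (fun t : ℂ => q + t • e) (𝓝 0) (𝓝 q) :=
    Continuous.tendsto' (by fun_prop) _ _ (by simp)
  have h2 : HasDerivAt (fun t : ℂ => fderiv ℂ F (q + t • e)) (fderiv ℂ (fderiv ℂ F) q e) 0 :=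
    HasFDerivAt.comp_hasDerivAt (f := fun t : ℂ => q + t • e) (l := fderiv ℂ F) 0
      (by simpa using hF.fderiv.differentiableAt.hasFDerivAt) hl
  have h3 := h2.clm_apply hv
  have h4 := h3.unique (hK.congr_of_eventuallyEq (hlc.eventually hFK))
  simp only [zero_smul, add_zero] at h4
  unfold dirDeriv
  have h5 := (hasFDerivAt_dirDeriv hF e).fderiv
  unfold dirDeriv at h5
  rw [h5, ContinuousLinearMap.flip_apply, hs (v q) e, ← h4]
  ring

/-- The total derivative `D_z F = F_z + w' F_w` along a Segre variety. -/
theorem hasDerivAt_graph {F : ℂ × ℂ → ℂ} {Θ : ℂ × ℂ × ℂ → ℂ} {q : ℂ × ℂ × ℂ}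
    (hF : AnalyticAt ℂ F (q.1, Θ q)) (hΘ : AnalyticAt ℂ Θ q) :
    HasDerivAt (fun t : ℂ => F ((q + t • ((1, 0, 0) : ℂ × ℂ × ℂ)).1,
      Θ (q + t • ((1, 0, 0) : ℂ × ℂ × ℂ))))
      (dirDeriv (1, 0) F (q.1, Θ q) + dirDeriv (1, 0, 0) Θ q * dirDeriv (0, 1) F (q.1, Θ q)) 0 := by
  have d1 : HasDerivAt (fun t : ℂ => (q + t • ((1, 0, 0) : ℂ × ℂ × ℂ)).1) 1 0 := by
    simpa using (hasDerivAt_id (0 : ℂ)).const_add q.1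
  have d := d1.prodMk (hasDerivAt_line_zero (1, 0, 0) hΘ)
  have h := HasFDerivAt.comp_hasDerivAt (l := F) (l' := fderiv ℂ F (q.1, Θ q))
    (f := fun t : ℂ => ((q + t • ((1, 0, 0) : ℂ × ℂ × ℂ)).1,
      Θ (q + t • ((1, 0, 0) : ℂ × ℂ × ℂ)))) 0
    (by simpa using hF.differentiableAt.hasFDerivAt) d
  rw [fderiv_pair, one_mul] at h
  exact h

/-- An infinitesimal symmetry of the Segre family satisfies the determining equation. -/
theorem determiningEquation_of_segre {m : ℕ} (hm : 2 ≤ m) {ε : ℝ} (hε : ε ≠ 0)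
    {R Θ Φ : ℂ × ℂ × ℂ → ℂ} (hR : AnalyticAt ℂ R 0)
    (hΘ : IsComplexDefiningFunction (admissibleFunction m ε R) Θ)
    (hΦ : IsAssociatedODE m Θ Φ) {P Q : ℂ × ℂ → ℂ} {Pc Qc : ℂ × ℂ → ℂ}
    (hP : AnalyticAt ℂ P 0) (hQ : AnalyticAt ℂ Q 0)
    (hPc : ContinuousAt Pc 0) (hQc : ContinuousAt Qc 0)
    (htan : ∀ᶠ q in 𝓝 0, fderiv ℂ Θ q (P (q.1, Θ q), Pc q.2, Qc q.2) = Q (q.1, Θ q)) :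
    (∀ᶠ q : ℂ × ℂ × ℂ in 𝓝 0, q.2.1 ≠ 0 → DeterminingEquation m Φ P Q q) ∧
    ∃ C : ℝ, ∀ᶠ q : ℂ × ℂ × ℂ in 𝓝 0, ‖dirDeriv (1, 0) Q (q.1, q.2.1)
      + (dirDeriv (0, 1) Q (q.1, q.2.1) - dirDeriv (1, 0) P (q.1, q.2.1)) * (q.2.1 ^ m * q.2.2)
      - dirDeriv (0, 1) P (q.1, q.2.1) * (q.2.1 ^ m * q.2.2) ^ 2
      - m * q.2.1 ^ (m - 1) * Q (q.1, q.2.1) * q.2.2‖ ≤ C * ‖q.2.1‖ ^ m := by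
  obtain ⟨g, hg, hslope, hzero, hg0, hmap⟩ := hΘ.exists_slope hm hε hR
  obtain ⟨hΘa, hΘ0, -⟩ := hΘ
  obtain ⟨hΦa, -, hsol⟩ := hΦ
  set v : ℂ × ℂ × ℂ → ℂ × ℂ × ℂ := fun q => (P (q.1, Θ q), Pc q.2, Qc q.2) with hv
  have tx : Tendsto (fun q : ℂ × ℂ × ℂ => (q.1, Θ q)) (𝓝 0) (𝓝 0) := by
    have : ContinuousAt (fun q : ℂ × ℂ × ℂ => (q.1, Θ q)) 0 :=
      continuousAt_fst.prodMk hΘa.continuousAt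
    simpa [ContinuousAt, hΘ0, Prod.mk_zero_zero] using this
  have ty : Tendsto (fun q : ℂ × ℂ × ℂ => (q.1, Θ q, g q)) (𝓝 0) (𝓝 0) := hmap.le
  set N : ℂ × ℂ × ℂ → ℂ := fun q => dirDeriv (1, 0) Q (q.1, Θ q)
    + dirDeriv (1, 0, 0) Θ q * dirDeriv (0, 1) Q (q.1, Θ q)
    - (dirDeriv (1, 0) P (q.1, Θ q) + dirDeriv (1, 0, 0) Θ q * dirDeriv (0, 1) P (q.1, Θ q))
      * dirDeriv (1, 0, 0) Θ q with hN
  have aP := tx.eventually hP.eventually_analyticAt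
  have aQ := tx.eventually hQ.eventually_analyticAt
  have dv : ∀ {q : ℂ × ℂ × ℂ}, AnalyticAt ℂ P (q.1, Θ q) → AnalyticAt ℂ Θ q →
      HasDerivAt (fun t : ℂ => v (q + t • ((1, 0, 0) : ℂ × ℂ × ℂ)))
        (dirDeriv (1, 0) P (q.1, Θ q)
          + dirDeriv (1, 0, 0) Θ q * dirDeriv (0, 1) P (q.1, Θ q), 0, 0) 0 := by
    intro q h1 h2
    -- `Pc` and `Qc` do not see the `z`-direction, so no differentiability of them is needed.
    have h3 : HasDerivAt (fun t : ℂ => ((Pc (q + t • ((1, 0, 0) : ℂ × ℂ × ℂ)).2,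
        Qc (q + t • ((1, 0, 0) : ℂ × ℂ × ℂ)).2) : ℂ × ℂ)) (0, 0) 0 := by
      simpa [Prod.mk_zero_zero] using hasDerivAt_const (0 : ℂ) (Pc q.2, Qc q.2)
    exact (hasDerivAt_graph h1 h2).prodMk h3
  -- First prolongation: `v Θ = Q` gives `v (Θ_z) = D_z Q - Θ_z D_z P`.
  have step1 : ∀ᶠ q in 𝓝 0, fderiv ℂ (dirDeriv (1, 0, 0) Θ) q (v q) = N q := by
    filter_upwards [htan.eventually_nhds, aP, aQ, hΘa.eventually_analyticAt] with q h1 h2 h3 h4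
    rw [fderiv_dirDeriv_of_fderiv_eq h4 h1 (dv h2 h4) (hasDerivAt_graph h3 h4), fderiv_triple]
    ring
  -- The same quantity computed from `Θ_z = Θ ^ m g`; comparison with `step1` determines `v g`, the
  -- `ζ`-component of the prolonged field.
  have step2 : ∀ᶠ q in 𝓝 0,
      fderiv ℂ (dirDeriv (1, 0, 0) Θ) q (v q) =
        m * Θ q ^ (m - 1) * Q (q.1, Θ q) * g q + Θ q ^ m * fderiv ℂ g q (v q) := by
    filter_upwards [hslope.eventually_nhds, htan, hΘa.eventually_analyticAt,
      hg.eventually_analyticAt] with q h1 h2 h3 h4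
    have hd : HasFDerivAt (fun x => Θ x ^ m * g x) _ q := (h3.differentiableAt.hasFDerivAt.pow m).mul h4.differentiableAt.hasFDerivAt
    rw [EventuallyEq.fderiv_eq h1, hd.fderiv]
    simp only [add_apply, smul_apply, smul_eq_mul]
    rw [← h2]
    simp only [nsmul_eq_mul]
    ring
  have ode : ∀ᶠ q : ℂ × ℂ × ℂ in 𝓝 0, q.2.2 ≠ 0 →
      dirDeriv (1, 0, 0) (dirDeriv (1, 0, 0) Θ) q = Θ q ^ m * Φ (q.1, Θ q, g q) := by
    filter_upwards [hsol, hslope, hzero, hΘa.eventually_analyticAt] with q h1 h2 h3 h4 h5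
    have hline : ∀ k, iteratedDeriv k (fun z => Θ (z, q.2.1, q.2.2)) q.1 =
        (dirDeriv (1, 0, 0))^[k] Θ q := by
      intro k
      have := iteratedDeriv_line (F := Θ) (c := (0, q.2.1, q.2.2)) (v := (1, 0, 0)) k (t := q.1)
        (by simpa [Prod.mk_zero_zero] using h4)
      simpa [Prod.mk_zero_zero] using this
    have e1 := h1 h5
    have e2 := hline 1
    rw [iteratedDeriv_one] at e2
    rw [hline 2, e2] at e1
    simp only [Function.iterate_succ, Function.iterate_zero, Function.comp_apply, id] at e1
    rw [e1, h2, mul_div_cancel_left₀ _ (pow_ne_zero m (h3.not.2 h5))]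
  have aΦ := ty.eventually hΦa.eventually_analyticAt
  have hne : ∀ {q : ℂ × ℂ × ℂ}, q.2.2 ≠ 0 → ∀ᶠ x : ℂ × ℂ × ℂ in 𝓝 q, x.2.2 ≠ 0 := by
    intro q hq
    have hc : ContinuousAt (fun x : ℂ × ℂ × ℂ => x.2.2) q := by fun_prop
    exact hc.eventually_ne hq
  -- Second prolongation: `v (Θ_zz)` is computed by exchanging `v` and `∂_z` once more, and also by
  -- applying `v` to `Θ ^ m Φ (z, Θ, g)`. Eliminating `v g` leaves the determining equation.
  have step3 : ∀ᶠ q : ℂ × ℂ × ℂ in 𝓝 0, q.2.2 ≠ 0 →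
      DeterminingEquation m Φ P Q (q.1, Θ q, g q) := by
    filter_upwards [step1.eventually_nhds, step2, ode.eventually_nhds, htan, aP, aQ,
      hΘa.eventually_analyticAt, hg.eventually_analyticAt, aΦ, hslope]
      with q h1 h2 h3 h4 hPq hQq hΘq hgq hΦq hs hq
    have ode' : ∀ᶠ x : ℂ × ℂ × ℂ in 𝓝 q,
        dirDeriv (1, 0, 0) (dirDeriv (1, 0, 0) Θ) x = Θ x ^ m * Φ (x.1, Θ x, g x) := by
      filter_upwards [h3, hne hq] with x hx1 hx2
      exact hx1 hx2
    have dp := hasDerivAt_line_zero (1, 0, 0) (analyticAt_dirDeriv hΘq (1, 0, 0))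
    have dN := ((hasDerivAt_graph (analyticAt_dirDeriv hQq (1, 0)) hΘq).add
      (dp.mul (hasDerivAt_graph (analyticAt_dirDeriv hQq (0, 1)) hΘq))).sub
      (((hasDerivAt_graph (analyticAt_dirDeriv hPq (1, 0)) hΘq).add
      (dp.mul (hasDerivAt_graph (analyticAt_dirDeriv hPq (0, 1)) hΘq))).mul dp)
    have e1 := fderiv_dirDeriv_of_fderiv_eq (analyticAt_dirDeriv hΘq (1, 0, 0)) h1 (dv hPq hΘq) dN
    have dG : HasFDerivAt (fun x : ℂ × ℂ × ℂ => (x.1, Θ x, g x)) _ q :=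
      hasFDerivAt_fst.prodMk
        (hΘq.differentiableAt.hasFDerivAt.prodMk hgq.differentiableAt.hasFDerivAt)
    have dΦ := HasFDerivAt.comp (g := Φ) (f := fun x : ℂ × ℂ × ℂ => (x.1, Θ x, g x)) q
      hΦq.differentiableAt.hasFDerivAt dG
    have hd : HasFDerivAt (fun x => Θ x ^ m * Φ (x.1, Θ x, g x)) _ q := (hΘq.differentiableAt.hasFDerivAt.pow m).mul dΦ
    rw [EventuallyEq.fderiv_eq ode', hd.fderiv] at e1
    simp only [add_apply, smul_apply, smul_eq_mul,
      Pi.mul_apply, Pi.add_apply, nsmul_eq_mul,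
      ContinuousLinearMap.comp_apply, ContinuousLinearMap.prod_apply,
      ContinuousLinearMap.coe_fst', fderiv_triple Φ, fderiv_triple (dirDeriv _ _), zero_smul,
      add_zero, zero_mul] at e1
    rw [h4, ode'.self_of_nhds] at e1
    have hv1 : (v q).1 = P (q.1, Θ q) := rfl
    rw [hv1] at e1
    have h2' := h2
    rw [h1.self_of_nhds] at h2'
    simp only [hN] at h2'
    have hQs : dirDeriv (1, 0) (dirDeriv (0, 1) Q) (q.1, Θ q) =
      dirDeriv (0, 1) (dirDeriv (1, 0) Q) (q.1, Θ q) := dirDeriv_comm hQq _ _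
    have hPs : dirDeriv (1, 0) (dirDeriv (0, 1) P) (q.1, Θ q) =
      dirDeriv (0, 1) (dirDeriv (1, 0) P) (q.1, Θ q) := dirDeriv_comm hPq _ _
    rw [hQs, hPs, hs] at e1
    rw [hs] at h2'
    simp only [DeterminingEquation]
    linear_combination (-1) * e1 - dirDeriv (0, 0, 1) Φ (q.1, Θ q, g q) * h2'
  constructor
  -- The Segre parameters cover a full neighbourhood of `0` in `(z, w, ζ)`.
  · rw [← hmap, eventually_map]
    filter_upwards [step3, hzero] with q h1 h2 h3
    exact h1 (h2.not.1 h3)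
  -- The expression to be bounded is `w ^ m (v g)`, and `v g` is continuous at `0`.
  · have hcont : ContinuousAt (fun q => fderiv ℂ g q (v q)) 0 := by
      refine hg.fderiv.continuousAt.clm_apply ?_
      have c1 : ContinuousAt (fun q : ℂ × ℂ × ℂ => P (q.1, Θ q)) 0 :=
        ContinuousAt.comp (f := fun q : ℂ × ℂ × ℂ => (q.1, Θ q)) (g := P)
          (by simpa [hΘ0, Prod.mk_zero_zero] using hP.continuousAt) (continuousAt_fst.prodMk hΘa.continuousAt)
      have c2 : ContinuousAt (fun q : ℂ × ℂ × ℂ => Pc q.2) 0 :=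
        ContinuousAt.comp (f := fun q : ℂ × ℂ × ℂ => q.2) (g := Pc) hPc continuousAt_snd
      have c3 : ContinuousAt (fun q : ℂ × ℂ × ℂ => Qc q.2) 0 :=
        ContinuousAt.comp (f := fun q : ℂ × ℂ × ℂ => q.2) (g := Qc) hQc continuousAt_snd
      exact c1.prodMk (c2.prodMk c3)
    refine ⟨‖fderiv ℂ g 0 (v 0)‖ + 1, ?_⟩
    rw [← hmap, eventually_map]
    have hlt : ∀ᶠ q in 𝓝 0, ‖fderiv ℂ g q (v q)‖ < ‖fderiv ℂ g 0 (v 0)‖ + 1 :=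
      hcont.norm.eventually (gt_mem_nhds (lt_add_one _))
    filter_upwards [step1, step2, hslope, hlt] with q h1 h2 h3 h4
    rw [h1] at h2
    simp only [hN, h3] at h2
    have h5 : dirDeriv (1, 0) Q (q.1, Θ q)
      + (dirDeriv (0, 1) Q (q.1, Θ q) - dirDeriv (1, 0) P (q.1, Θ q)) * (Θ q ^ m * g q)
      - dirDeriv (0, 1) P (q.1, Θ q) * (Θ q ^ m * g q) ^ 2
      - m * Θ q ^ (m - 1) * Q (q.1, Θ q) * g q = fderiv ℂ g q (v q) * Θ q ^ m := by
      linear_combination h2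
    rw [h5, norm_mul, norm_pow]
    gcongr

end Prolongation
-- Uniqueness from a totally real subspace.
section Complexification

theorem eqOn_zero_ball_of_real {f : ℂ → ℂ} {s : ℝ} (hf : DifferentiableOn ℂ f (Metric.ball 0 s))
    (h : ∀ t : ℝ, |t| < s → f t = 0) {z : ℂ} (hz : ‖z‖ < s) : f z = 0 := by
  have hs : 0 < s := (norm_nonneg z).trans_lt hz
  have ha : AnalyticOnNhd ℂ f (Metric.ball 0 s) := hf.analyticOnNhd Metric.isOpen_ball
  refine ha.eqOn_zero_of_preconnected_of_frequently_eq_zero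
    (convex_ball (0 : ℂ) s).isPreconnected (Metric.mem_ball_self hs) ?_
    (by simpa using hz : z ∈ Metric.ball (0 : ℂ) s)
  have hc : Tendsto (fun t : ℝ => (t : ℂ)) (𝓝[≠] 0) (𝓝[≠] 0) := by
    refine tendsto_nhdsWithin_of_tendsto_nhds_of_eventually_within _ ?_ ?_
    · exact (Complex.continuous_ofReal.tendsto' 0 0 (by simp)).mono_left nhdsWithin_le_nhds
    · filter_upwards [self_mem_nhdsWithin] with t ht
      simpa using ht
  refine hc.frequently (Eventually.frequently ?_)
  have : ∀ᶠ t : ℝ in 𝓝 0, |t| < s :=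
    (continuous_abs.tendsto' (0 : ℝ) 0 (by simp)).eventually (gt_mem_nhds hs)
  filter_upwards [this.filter_mono nhdsWithin_le_nhds] with t ht
  exact h t ht

/-- A holomorphic function that vanishes on `{χ = z̄, u ∈ ℝ}` vanishes identically. -/
theorem eventually_eq_zero_of_totally_real {G : ℂ × ℂ × ℂ → ℂ}
    (hG : ∀ᶠ q in 𝓝 0, DifferentiableAt ℂ G q)
    (h : ∀ᶠ y : ℂ × ℝ in 𝓝 0, G (y.1, starRingEnd ℂ y.1, (y.2 : ℂ)) = 0) :
    ∀ᶠ q in 𝓝 0, G q = 0 := by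
  obtain ⟨r1, hr1, h1⟩ := Metric.eventually_nhds_iff_ball.1 hG
  obtain ⟨r2, hr2, h2⟩ := Metric.eventually_nhds_iff_ball.1 h
  set r := min r1 r2
  have hr : 0 < r := lt_min hr1 hr2
  -- In the variables `x = (z + χ) / 2`, `y = (z - χ) / (2 i)`, `u` the hypothesis concerns real
  -- arguments, and these are made complex one at a time. Radius `r / 2` keeps `x ± i y` within `r`.
  have hD : ∀ x y u : ℂ, ‖x‖ < r / 2 → ‖y‖ < r / 2 → ‖u‖ < r / 2 →
      DifferentiableAt ℂ G (x + Complex.I * y, x - Complex.I * y, u) := by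
    intro x y u hx hy hu
    apply h1
    have hIy : ‖Complex.I * y‖ = ‖y‖ := by simp
    have e1 : ‖x + Complex.I * y‖ < r := by
      have := norm_add_le x (Complex.I * y)
      linarith
    have e2 : ‖x - Complex.I * y‖ < r := by
      have := norm_sub_le x (Complex.I * y)
      linarith
    have hle : r ≤ r1 := min_le_left _ _
    rw [mem_ball_zero_iff]
    simp only [Prod.norm_def, sup_lt_iff]
    exact ⟨by linarith, by linarith, by linarith⟩
  have s1 : ∀ x y u : ℝ, |x| < r / 2 → |y| < r / 2 → |u| < r / 2 →
      G (x + Complex.I * y, x - Complex.I * y, u) = 0 := by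
    intro x y u hx hy hu
    have hle : r ≤ r2 := min_le_right _ _
    have hmem : (((x + Complex.I * y : ℂ), u) : ℂ × ℝ) ∈ Metric.ball (0 : ℂ × ℝ) r2 := by
      rw [mem_ball_zero_iff]
      simp only [Prod.norm_def, sup_lt_iff, Real.norm_eq_abs]
      have := norm_add_le (x : ℂ) (Complex.I * y)
      simp only [Complex.norm_mul, Complex.norm_I, one_mul, Complex.norm_real,
        Real.norm_eq_abs] at this
      exact ⟨by linarith, by linarith⟩
    have := h2 _ hmem
    simpa [← sub_eq_add_neg] using this
  have s2 : ∀ (x : ℂ) (y u : ℝ), ‖x‖ < r / 2 → |y| < r / 2 → |u| < r / 2 →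
      G (x + Complex.I * y, x - Complex.I * y, u) = 0 := by
    intro x y u hx hy hu
    refine eqOn_zero_ball_of_real (f := fun x => G (x + Complex.I * y, x - Complex.I * y, u))
      (s := r / 2) (fun t ht => ?_) (fun t ht => s1 t y u ht hy hu) hx
    exact (DifferentiableAt.comp t (hD t y u (by simpa using ht) (by simpa using hy)
      (by simpa using hu)) (by fun_prop)).differentiableWithinAt
  have s3 : ∀ (x y : ℂ) (u : ℝ), ‖x‖ < r / 2 → ‖y‖ < r / 2 → |u| < r / 2 →
      G (x + Complex.I * y, x - Complex.I * y, u) = 0 := by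
    intro x y u hx hy hu
    refine eqOn_zero_ball_of_real (f := fun y => G (x + Complex.I * y, x - Complex.I * y, u))
      (s := r / 2) (fun t ht => ?_) (fun t ht => s2 x t u hx ht hu) hy
    exact (DifferentiableAt.comp t (hD x t u hx (by simpa using ht)
      (by simpa using hu)) (by fun_prop)).differentiableWithinAt
  have s4 : ∀ x y u : ℂ, ‖x‖ < r / 2 → ‖y‖ < r / 2 → ‖u‖ < r / 2 →
      G (x + Complex.I * y, x - Complex.I * y, u) = 0 := by
    intro x y u hx hy hu
    refine eqOn_zero_ball_of_real (f := fun u => G (x + Complex.I * y, x - Complex.I * y, u))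
      (s := r / 2) (fun t ht => ?_) (fun t ht => s3 x y t hx hy ht) hu
    exact (DifferentiableAt.comp t (hD x y t hx hy (by simpa using ht))
      (by fun_prop)).differentiableWithinAt
  filter_upwards [Metric.ball_mem_nhds (0 : ℂ × ℂ × ℂ) (half_pos hr)] with q hq
  obtain ⟨z, χ, u⟩ := q
  rw [mem_ball_zero_iff] at hq
  simp only [Prod.norm_def, sup_lt_iff] at hq
  obtain ⟨hz, hχ, hu⟩ := hq
  have hx : ‖(z + χ) / 2‖ < r / 2 := by
    have := norm_add_le z χ
    rw [norm_div, Complex.norm_two]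
    linarith
  have hy : ‖(z - χ) / (2 * Complex.I)‖ < r / 2 := by
    have := norm_sub_le z χ
    rw [norm_div, norm_mul, Complex.norm_I, Complex.norm_two]
    linarith
  have := s4 _ _ u hx hy hu
  convert this using 3
  · field_simp
    ring
  · field_simp
    ring_nf

end Complexification
-- Tangency to `M` and invariance of the Segre family.
section Tangency

/-- The real-linear map `(z, w) ↦ (z, z̄, Re w)`. -/
noncomputable def realPoint : (ℂ × ℂ) →L[ℝ] (ℂ × ℂ × ℂ) :=
  (ContinuousLinearMap.fst ℝ ℂ ℂ).prod
    (((Complex.conjCLE : ℂ →L[ℝ] ℂ).comp (ContinuousLinearMap.fst ℝ ℂ ℂ)).prod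
      ((Complex.ofRealCLM.comp Complex.reCLM).comp (ContinuousLinearMap.snd ℝ ℂ ℂ)))

/-- The real-linear map `(z, w) ↦ Im w`, with values in `ℂ`. -/
noncomputable def imaginaryPart : (ℂ × ℂ) →L[ℝ] ℂ :=
  (Complex.ofRealCLM.comp Complex.imCLM).comp (ContinuousLinearMap.snd ℝ ℂ ℂ)

theorem realPoint_apply (x : ℂ × ℂ) :
    realPoint x = (x.1, starRingEnd ℂ x.1, ((x.2.re : ℝ) : ℂ)) := rfl

theorem imaginaryPart_apply (x : ℂ × ℂ) : imaginaryPart x = ((x.2.im : ℝ) : ℂ) := rfl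

/-- The function `v - F (z, z̄, u)` of `(z, u + i v)`. -/
noncomputable def graphFunction (F : ℂ × ℂ × ℂ → ℂ) : ℂ × ℂ → ℂ :=
  fun x => imaginaryPart x - F (realPoint x)

theorem hasFDerivAt_graphFunction {F : ℂ × ℂ × ℂ → ℂ} {x : ℂ × ℂ}
    (hF : AnalyticAt ℂ F (realPoint x)) :
    HasFDerivAt (graphFunction F)
      (imaginaryPart - ((fderiv ℂ F (realPoint x)).restrictScalars ℝ).comp realPoint) x :=
  imaginaryPart.hasFDerivAt.sub
    (HasFDerivAt.comp x (hF.differentiableAt.hasFDerivAt.restrictScalars ℝ) realPoint.hasFDerivAt)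

theorem analyticAt_graphFunction {F : ℂ × ℂ × ℂ → ℂ} {x : ℂ × ℂ}
    (hF : AnalyticAt ℂ F (realPoint x)) : AnalyticAt ℝ (graphFunction F) x :=
  (imaginaryPart.analyticAt x).sub
    (AnalyticAt.fun_comp (f := realPoint) hF.restrictScalars (realPoint.analyticAt x))

/-- Tangency to a graph `v = F (z, z̄, u)`, for one suitable defining function. -/
theorem IsInfinitesimalAutomorphism.tangent_graph {M : Set (ℂ × ℂ)} {p : ℂ × ℂ}
    {H : ℂ × ℂ → ℂ × ℂ} {F : ℂ × ℂ × ℂ → ℂ} {X : ℂ × ℂ → ℂ × ℂ}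
    (hH : IsCoordinateSystem p H) (hF : IsRealGerm F) (hF0 : F 0 = 0)
    (hM : IsGraphIn M p H F)
    (hX : IsInfinitesimalAutomorphism M p X) :
    ∀ᶠ Z in 𝓝 p, Z ∈ M →
      imaginaryPart (fderiv ℂ H Z (X Z))
        = fderiv ℂ F (realPoint (H Z)) (realPoint (fderiv ℂ H Z (X Z))) := by
  obtain ⟨hHa, hHp, hHb⟩ := hH
  obtain ⟨hFa, hFr⟩ := hF
  set ρ : ℂ × ℂ → ℂ := fun Z => graphFunction F (H Z) with hρ
  have tH : Tendsto H (𝓝 p) (𝓝 0) := by simpa [ContinuousAt, hHp] using hHa.continuousAt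
  have tJ : Tendsto (fun Z => realPoint (H Z)) (𝓝 p) (𝓝 0) :=
    (realPoint.continuous.tendsto' 0 0 (map_zero _)).comp tH
  have hFre : ∀ᶠ Z in 𝓝 p, (F (realPoint (H Z))).im = 0 := by
    have hc : Tendsto (fun x : ℂ × ℂ => ((x.1, x.2.re) : ℂ × ℝ)) (𝓝 0) (𝓝 0) :=
      Continuous.tendsto' (by fun_prop) _ _ (by simp)
    exact (hc.comp tH).eventually hFr
  have hreal : ∀ᶠ Z in 𝓝 p, ρ Z = (((ρ Z).re : ℝ) : ℂ) := by
    filter_upwards [hFre] with Z hZ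
    apply Complex.ext <;> simp [hρ, graphFunction, imaginaryPart_apply, hZ]
  have dρ : ∀ {Z}, AnalyticAt ℂ F (realPoint (H Z)) → AnalyticAt ℂ H Z → HasFDerivAt ρ
      ((imaginaryPart - ((fderiv ℂ F (realPoint (H Z))).restrictScalars ℝ).comp realPoint).comp
        ((fderiv ℂ H Z).restrictScalars ℝ)) Z := fun h1 h2 =>
    (hasFDerivAt_graphFunction h1).comp _ (h2.differentiableAt.hasFDerivAt.restrictScalars ℝ)
  have hFp : AnalyticAt ℂ F (realPoint (H p)) := by simpa [hHp] using hFa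
  have hρa : AnalyticAt ℝ ρ p :=
    AnalyticAt.fun_comp (f := H) (analyticAt_graphFunction hFp) hHa.restrictScalars
  have hdef : IsDefiningFunction M p (fun Z => (ρ Z).re) := by
    refine ⟨(Complex.reCLM.analyticAt _).comp hρa, ?_, ?_, ?_⟩
    · simp [hρ, graphFunction, hHp, hF0]
    · obtain ⟨V, hV⟩ := hHb.2 (0, Complex.I)
      have hd := (Complex.reCLM.hasFDerivAt.comp p (dρ hFp hHa)).fderiv
      intro h0
      have h1 : fderiv ℝ (fun Z => (ρ Z).re) p V = 1 := by
        have h2 : fderiv ℝ (fun Z => (ρ Z).re) p = _ := hd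
        rw [h2]
        simp [hV, realPoint_apply, imaginaryPart_apply, Prod.mk_zero_zero]
      rw [h0] at h1
      simp at h1
    · filter_upwards [hM, hreal] with Z h1 h2
      rw [h1, ← Complex.ofReal_eq_zero, ← h2]
      simp only [hρ, graphFunction, imaginaryPart_apply, realPoint_apply, sub_eq_zero]
  have hFev := tJ.eventually hFa.eventually_analyticAt
  filter_upwards [hX.2 _ hdef, hreal.eventually_nhds, hFev, hHa.eventually_analyticAt]
    with Z h1 h2 h3 h4 hZ
  have hd := dρ h3 h4
  have hr : HasFDerivAt (fun Z => (ρ Z).re) _ Z := Complex.reCLM.hasFDerivAt.comp Z hd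
  -- `ρ` is real-valued near `Z`, so its complex-valued differential also kills `X Z`.
  have hc : HasFDerivAt (fun Z => (((ρ Z).re : ℝ) : ℂ)) _ Z :=
    Complex.ofRealCLM.hasFDerivAt.comp Z hr.differentiableAt.hasFDerivAt
  have hu := hd.unique (hc.congr_of_eventuallyEq h2)
  have hu' := DFunLike.congr_fun hu (X Z)
  simp only [ContinuousLinearMap.comp_apply, h1 hZ, map_zero, sub_apply,
    ContinuousLinearMap.coe_restrictScalars', sub_eq_zero] at hu'
  exact hu'

theorem admissibleFunction_analyticAt {m : ℕ} {ε : ℝ} {R : ℂ × ℂ × ℂ → ℂ} (hR : AnalyticAt ℂ R 0) :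
    AnalyticAt ℂ (admissibleFunction m ε R) 0 := by
  have p1 : AnalyticAt ℂ (fun q : ℂ × ℂ × ℂ => q.1) 0 := analyticAt_fst
  have p2 : AnalyticAt ℂ (fun q : ℂ × ℂ × ℂ => q.2.1) 0 := analyticAt_fst.comp analyticAt_snd
  have p3 : AnalyticAt ℂ (fun q : ℂ × ℂ × ℂ => q.2.2) 0 := analyticAt_snd.comp analyticAt_snd
  exact (analyticAt_const.mul (p3.pow m)).mul
    (((analyticAt_const.mul p1).mul p2).add (((p1.pow 2).mul (p2.pow 2)).mul hR))

theorem admissibleFunction_isRealGerm {m : ℕ} {ε : ℝ} {R : ℂ × ℂ × ℂ → ℂ} (hR : IsRealGerm R) :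
    IsRealGerm (admissibleFunction m ε R) := by
  refine ⟨admissibleFunction_analyticAt hR.1, ?_⟩
  filter_upwards [hR.2] with q hq
  rw [← Complex.conj_eq_iff_im] at hq ⊢
  simp only [admissibleFunction, map_mul, map_add, map_pow, map_div₀, map_one, map_ofNat,
    Complex.conj_ofReal, Complex.conj_conj, hq]
  ring

/-- The function vanishes on the line `z = χ = 0`. This keeps `F_u + i` away from `0` when the
tangency equation is solved on the graph of `Θ`. -/
theorem dirDeriv_admissibleFunction {m : ℕ} {ε : ℝ} {R : ℂ × ℂ × ℂ → ℂ} (hR : AnalyticAt ℂ R 0) :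
    dirDeriv (0, 0, 1) (admissibleFunction m ε R) 0 = 0 := by
  have h := hasDerivAt_line_zero (0, 0, 1) (admissibleFunction_analyticAt (m := m) (ε := ε) hR)
  refine h.unique ?_
  simpa [admissibleFunction] using hasDerivAt_const (0 : ℂ) (0 : ℂ)

/-- In admissible coordinates, an infinitesimal automorphism preserves the Segre family. -/
theorem IsInfinitesimalAutomorphism.segre_tangent {m : ℕ} {M : Set (ℂ × ℂ)} {p : ℂ × ℂ}
    {H K : ℂ × ℂ → ℂ × ℂ} {ε : ℝ} {R Θ : ℂ × ℂ × ℂ → ℂ} {X : ℂ × ℂ → ℂ × ℂ}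
    (hadm : IsAdmissible m M p H ε R)
    (hΘ : IsComplexDefiningFunction (admissibleFunction m ε R) Θ)
    (hX : IsInfinitesimalAutomorphism M p X)
    (hK : Tendsto K (𝓝 0) (𝓝 p)) (hHK : ∀ᶠ x in 𝓝 0, H (K x) = x) {P Q : ℂ × ℂ → ℂ}
    (hP : AnalyticAt ℂ P 0) (hQ : AnalyticAt ℂ Q 0)
    (hPQ : ∀ᶠ x in 𝓝 0, fderiv ℂ H (K x) (X (K x)) = (P x, Q x)) :
    ∀ᶠ q : ℂ × ℂ × ℂ in 𝓝 0, fderiv ℂ Θ q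
      (P (q.1, Θ q), (star ∘ P ∘ star) q.2, (star ∘ Q ∘ star) q.2) = Q (q.1, Θ q) := by
  obtain ⟨hcoord, -, hRreal, hgraph⟩ := hadm
  obtain ⟨hΘa, hΘ0, hΘe⟩ := hΘ
  set F := admissibleFunction m ε R with hFdef
  have hFreal : IsRealGerm F := admissibleFunction_isRealGerm hRreal
  have hFa : AnalyticAt ℂ F 0 := hFreal.1
  have hF0 : F 0 = 0 := by simp [hFdef, admissibleFunction]
  have hFu : dirDeriv (0, 0, 1) F 0 = 0 := dirDeriv_admissibleFunction hRreal.1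
  have htan := hX.tangent_graph hcoord hFreal hF0 hgraph
  clear_value F
  set Ps := star ∘ P ∘ star with hPs
  set Qs := star ∘ Q ∘ star with hQs
  have dstar : ∀ {f : ℂ × ℂ → ℂ}, AnalyticAt ℂ f 0 →
      ∀ᶠ x in 𝓝 (0 : ℂ × ℂ), DifferentiableAt ℂ (star ∘ f ∘ star) x := by
    intro f hf
    have hc : Tendsto (star : ℂ × ℂ → ℂ × ℂ) (𝓝 0) (𝓝 0) :=
      continuous_star.tendsto' _ _ (star_zero _)
    filter_upwards [hc.eventually hf.eventually_analyticAt] with x hx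
    simpa using hx.differentiableAt.star_star
  -- the complexified tangency equation
  set w : ℂ × ℂ × ℂ → ℂ := fun q => q.2.2 + Complex.I * F q with hw
  set τ : ℂ × ℂ × ℂ → ℂ := fun q => q.2.2 - Complex.I * F q with hτ
  have cw : Tendsto (fun q : ℂ × ℂ × ℂ => (q.1, w q)) (𝓝 0) (𝓝 0) := by
    have hc := hFa.continuousAt
    have : ContinuousAt (fun q : ℂ × ℂ × ℂ => (q.1, w q)) 0 := by fun_prop
    simpa [ContinuousAt, hw, hF0, Prod.mk_zero_zero] using this
  have cτ : Tendsto (fun q : ℂ × ℂ × ℂ => (q.2.1, τ q)) (𝓝 0) (𝓝 0) := by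
    have hc := hFa.continuousAt
    have : ContinuousAt (fun q : ℂ × ℂ × ℂ => (q.2.1, τ q)) 0 := by fun_prop
    simpa [ContinuousAt, hτ, hF0, Prod.mk_zero_zero] using this
  -- The tangency equation with `z̄`, `w̄` replaced by independent `χ`, `τ`. It holds for `χ = z̄`
  -- and real `u`, where `(z, u + i F)` lies on `M`, and so holds identically.
  set G : ℂ × ℂ × ℂ → ℂ := fun q =>
    (Q (q.1, w q) - Qs (q.2.1, τ q)) / (2 * Complex.I) - fderiv ℂ F q
      (P (q.1, w q), Ps (q.2.1, τ q), (Q (q.1, w q) + Qs (q.2.1, τ q)) / 2) with hG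
  have hGd : ∀ᶠ q in 𝓝 0, DifferentiableAt ℂ G q := by
    filter_upwards [cw.eventually hP.eventually_analyticAt, cw.eventually hQ.eventually_analyticAt,
      cτ.eventually (dstar hP), cτ.eventually (dstar hQ), hFa.eventually_analyticAt]
      with q h1 h2 h3 h4 h5
    have dF := h5.differentiableAt
    have dw : DifferentiableAt ℂ (fun q : ℂ × ℂ × ℂ => (q.1, w q)) q := by fun_prop
    have dτ : DifferentiableAt ℂ (fun q : ℂ × ℂ × ℂ => (q.2.1, τ q)) q := by fun_prop
    have g1 : DifferentiableAt ℂ (fun q : ℂ × ℂ × ℂ => P (q.1, w q)) q :=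
      h1.differentiableAt.fun_comp' q dw
    have g2 : DifferentiableAt ℂ (fun q : ℂ × ℂ × ℂ => Q (q.1, w q)) q :=
      h2.differentiableAt.fun_comp' q dw
    have g3 : DifferentiableAt ℂ (fun q : ℂ × ℂ × ℂ => Ps (q.2.1, τ q)) q :=
      h3.fun_comp' q dτ
    have g4 : DifferentiableAt ℂ (fun q : ℂ × ℂ × ℂ => Qs (q.2.1, τ q)) q :=
      h4.fun_comp' q dτ
    have g5 := h5.fderiv.differentiableAt
    have g6 : DifferentiableAt ℂ
        (fun q : ℂ × ℂ × ℂ => (Q (q.1, w q) + Qs (q.2.1, τ q)) / 2) q := by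
      simp only [div_eq_mul_inv]
      exact (g2.add g4).mul_const _
    have g7 : DifferentiableAt ℂ
        (fun q : ℂ × ℂ × ℂ => (Q (q.1, w q) - Qs (q.2.1, τ q)) / (2 * Complex.I)) q := by
      simp only [div_eq_mul_inv]
      exact (g2.sub g4).mul_const _
    exact g7.sub
      (g5.clm_apply (g1.prodMk (g3.prodMk g6)))
  have hGreal : ∀ᶠ y : ℂ × ℝ in 𝓝 0, G (y.1, starRingEnd ℂ y.1, (y.2 : ℂ)) = 0 := by
    have hy : Tendsto (fun y : ℂ × ℝ => ((y.1, starRingEnd ℂ y.1, (y.2 : ℂ)) : ℂ × ℂ × ℂ))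
        (𝓝 0) (𝓝 0) := by
      refine Continuous.tendsto' ?_ _ _ (by simp)
      exact continuous_fst.prodMk ((Complex.continuous_conj.comp continuous_fst).prodMk
        (Complex.continuous_ofReal.comp continuous_snd))
    have hyw := cw.comp hy
    have hyK := hK.comp hyw
    filter_upwards [hFreal.2, hyw.eventually hHK, hyw.eventually hPQ, hyK.eventually hgraph,
      hyK.eventually htan] with y h1 h2 h3 h4 h5
    simp only [Function.comp_apply] at h2 h3 h4 h5
    set q : ℂ × ℂ × ℂ := (y.1, starRingEnd ℂ y.1, (y.2 : ℂ)) with hq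
    have hFq : F q = (((F q).re : ℝ) : ℂ) := by
      apply Complex.ext <;> simp [h1]
    have hwre : (w q).re = y.2 := by
      simp only [hw, hq] at h1 ⊢
      simp [h1]
    have hwim : (((w q).im : ℝ) : ℂ) = F q := by
      rw [hFq]
      simp [hw, hq]
    have hJ : realPoint (q.1, w q) = q := by
      rw [realPoint_apply, hwre]
    rw [h2] at h4 h5
    rw [h3, hJ] at h5
    have hmem : K (q.1, w q) ∈ M := by
      rw [h4]
      change _ = F (realPoint (q.1, w q))
      rw [hJ]
      exact hwim
    have h6 := h5 hmem
    have hst : (star ((q.2.1, τ q) : ℂ × ℂ)) = (q.1, w q) := by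
      refine Prod.ext (by simp [hq]) ?_
      simp only [hτ, hw]
      rw [hFq]
      simp [hq]
    have hPs' : Ps (q.2.1, τ q) = starRingEnd ℂ (P (q.1, w q)) := by
      simp only [hPs, Function.comp_apply, hst]
      rfl
    have hQs' : Qs (q.2.1, τ q) = starRingEnd ℂ (Q (q.1, w q)) := by
      simp only [hQs, Function.comp_apply, hst]
      rfl
    simp only [hG]
    rw [hPs', hQs', ← Complex.re_eq_add_conj, ← Complex.im_eq_sub_conj]
    rw [realPoint_apply, imaginaryPart_apply] at h6
    rw [h6, sub_self]
  have hG0 := eventually_eq_zero_of_totally_real hGd hGreal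
  -- restriction to the graph of `Θ`
  have cΘ : Tendsto (fun q : ℂ × ℂ × ℂ => ((q.1, q.2.1, (Θ q + q.2.2) / 2) : ℂ × ℂ × ℂ))
      (𝓝 0) (𝓝 0) := by
    have hc := hΘa.continuousAt
    have : ContinuousAt (fun q : ℂ × ℂ × ℂ => ((q.1, q.2.1, (Θ q + q.2.2) / 2) : ℂ × ℂ × ℂ)) 0 := by
      fun_prop
    simpa [ContinuousAt, hΘ0, Prod.mk_zero_zero] using this
  have hne : ∀ᶠ q in 𝓝 0, dirDeriv (0, 0, 1) F q ≠ -Complex.I :=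
    (analyticAt_dirDeriv hFa (0, 0, 1)).continuousAt.eventually_ne (by rw [hFu]; simp)
  filter_upwards [hΘe.eventually_nhds, cΘ.eventually hG0, cΘ.eventually hne,
    cΘ.eventually hFa.eventually_analyticAt, hΘa.eventually_analyticAt] with q h1 h2 h3 h4 h5
  have hΘd := h5.differentiableAt.hasFDerivAt
  have d3 : HasFDerivAt (fun q : ℂ × ℂ × ℂ => q.2.2) ((ContinuousLinearMap.snd ℂ ℂ ℂ).comp
    (ContinuousLinearMap.snd ℂ ℂ (ℂ × ℂ))) q := hasFDerivAt_snd.comp q hasFDerivAt_snd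
  have d2 : HasFDerivAt (fun q : ℂ × ℂ × ℂ => q.2.1) ((ContinuousLinearMap.fst ℂ ℂ ℂ).comp
    (ContinuousLinearMap.snd ℂ ℂ (ℂ × ℂ))) q := hasFDerivAt_fst.comp q hasFDerivAt_snd
  have dl := (hΘd.sub d3).mul_const (2 * Complex.I)⁻¹
  have du := (hΘd.add d3).mul_const (2 : ℂ)⁻¹
  simp only [Pi.sub_apply, Pi.add_apply, ← div_eq_mul_inv] at dl du
  have dr : HasFDerivAt (fun q : ℂ × ℂ × ℂ => F (q.1, q.2.1, (Θ q + q.2.2) / 2)) _ q :=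
    HasFDerivAt.comp (g := F) (f := fun q : ℂ × ℂ × ℂ => (q.1, q.2.1, (Θ q + q.2.2) / 2)) q
      h4.differentiableAt.hasFDerivAt (hasFDerivAt_fst.prodMk (d2.prodMk du))
  have he := dl.unique (dr.congr_of_eventuallyEq h1)
  have hq0 := h1.self_of_nhds
  have hI : (2 * Complex.I) ≠ 0 := by simp
  have hwq : w (q.1, q.2.1, (Θ q + q.2.2) / 2) = Θ q := by
    simp only [hw]
    rw [← hq0]
    field_simp
    ring
  have hτq : τ (q.1, q.2.1, (Θ q + q.2.2) / 2) = q.2.2 := by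
    simp only [hτ]
    rw [← hq0]
    field_simp
    ring
  simp only [hG, hwq, hτq] at h2
  have hv := DFunLike.congr_fun he (P (q.1, Θ q), Ps q.2, Qs q.2)
  simp only [ContinuousLinearMap.comp_apply, ContinuousLinearMap.prod_apply, add_apply, sub_apply,
    smul_apply, smul_eq_mul, ContinuousLinearMap.coe_fst', ContinuousLinearMap.coe_snd',
    fderiv_triple F, Prod.mk.eta] at hv h2
  set Fu := dirDeriv (0, 0, 1) F (q.1, q.2.1, (Θ q + q.2.2) / 2)
  set δ := fderiv ℂ Θ q (P (q.1, Θ q), Ps q.2, Qs q.2)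
  -- The difference between `G = 0` and the defining equation of `Θ` differentiated along the field.
  have hfin : (Fu + Complex.I) * (δ - Q (q.1, Θ q)) = 0 := by
    have hinv : (2 * Complex.I)⁻¹ = -Complex.I / 2 := by
      rw [mul_inv, Complex.inv_I]; ring
    rw [div_eq_mul_inv, hinv] at h2
    rw [hinv] at hv
    linear_combination 2 * h2 - 2 * hv
  have h3' : Fu + Complex.I ≠ 0 := fun h => h3 (eq_neg_of_add_eq_zero_left h)
  exact sub_eq_zero.1 ((mul_eq_zero.1 hfin).resolve_left h3')

end Tangency
-- The transversal jet and the dimension bound.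
section Jet

open scoped ContDiff in
theorem IsCoordinateSystem.exists_inverse {p : ℂ × ℂ} {H : ℂ × ℂ → ℂ × ℂ}
    (hH : IsCoordinateSystem p H) :
    ∃ K : ℂ × ℂ → ℂ × ℂ, AnalyticAt ℂ K 0 ∧ K 0 = p ∧ (∀ᶠ x in 𝓝 0, H (K x) = x) ∧
      ∀ᶠ Z in 𝓝 p, K (H Z) = Z := by
  obtain ⟨ha, hc, hb⟩ := hH
  set e := ContinuousLinearEquiv.ofBijective (fderiv ℂ H p)
    (LinearMap.ker_eq_bot.2 hb.1) (LinearMap.range_eq_top.2 hb.2)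
  have he : HasStrictFDerivAt H (e : (ℂ × ℂ) →L[ℂ] (ℂ × ℂ)) p := ha.hasStrictFDerivAt
  have h1 : ContDiffAt ℂ ω H p := ha.contDiffAt
  refine ⟨he.localInverse H e p, ?_, ?_, ?_, he.eventually_left_inverse⟩
  · have := h1.to_localInverse he.hasFDerivAt (by simp)
    rw [hc] at this
    exact this.analyticAt
  · rw [← hc]
    exact he.localInverse_apply_image
  · have := he.eventually_right_inverse
    rwa [hc] at this

/-- The vector field `X` in the coordinates `H`, with inverse `K`. -/
noncomputable def inCoordinates (H K : ℂ × ℂ → ℂ × ℂ) (X : ℂ × ℂ → ℂ × ℂ) : ℂ × ℂ → ℂ × ℂ :=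
  fun x => fderiv ℂ H (K x) (X (K x))

theorem analyticAt_inCoordinates {H K X : ℂ × ℂ → ℂ × ℂ} {p : ℂ × ℂ} (hH : AnalyticAt ℂ H p)
    (hK : AnalyticAt ℂ K 0) (hK0 : K 0 = p) (hX : AnalyticAt ℂ X p) :
    AnalyticAt ℂ (inCoordinates H K X) 0 := by
  have h1 : AnalyticAt ℂ (fun x => fderiv ℂ H (K x)) 0 :=
    AnalyticAt.fun_comp (f := K) (by rw [hK0]; exact hH.fderiv) hK
  have h2 : AnalyticAt ℂ (fun x => X (K x)) 0 :=
    AnalyticAt.fun_comp (f := K) (by rw [hK0]; exact hX) hK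
  exact AnalyticAt.comp₂ (f := fun x => fderiv ℂ H (K x)) (g := fun x => X (K x))
    (h := fun y : ((ℂ × ℂ) →L[ℂ] ℂ × ℂ) × ℂ × ℂ => y.1 y.2)
    ((ContinuousLinearMap.id ℂ ((ℂ × ℂ) →L[ℂ] ℂ × ℂ)).analyticAt_bilinear _) h1 h2

/-- The `m`-th derivative at `0` of `Q (0, w)`, where `P ∂_z + Q ∂_w` is `X` in coordinates. -/
noncomputable def transversalJet (m : ℕ) (H K : ℂ × ℂ → ℂ × ℂ) (X : ℂ × ℂ → ℂ × ℂ) : ℂ :=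
  iteratedDeriv m (fun w => (inCoordinates H K X (0, w)).2) 0

/-- Makes the jet depend only on the germ, so that `autJet` may use any representative. -/
theorem transversalJet_congr {m : ℕ} {H K X X' : ℂ × ℂ → ℂ × ℂ} {p : ℂ × ℂ}
    (hK : Tendsto K (𝓝 0) (𝓝 p)) (h : X =ᶠ[𝓝 p] X') :
    transversalJet m H K X = transversalJet m H K X' := by
  refine EventuallyEq.iteratedDeriv_eq m ?_
  have hc : Tendsto (fun w : ℂ => ((0, w) : ℂ × ℂ)) (𝓝 0) (𝓝 0) :=
    Continuous.tendsto' (by fun_prop) _ _ rfl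
  filter_upwards [(hK.comp hc).eventually h] with w hw
  simp only [Function.comp_apply] at hw
  simp only [inCoordinates, hw]

theorem contDiffAt_axis_inCoordinates {H K X : ℂ × ℂ → ℂ × ℂ} {p : ℂ × ℂ} (m : ℕ)
    (hH : AnalyticAt ℂ H p) (hK : AnalyticAt ℂ K 0) (hK0 : K 0 = p) (hX : AnalyticAt ℂ X p) :
    ContDiffAt ℂ m (fun w => (inCoordinates H K X (0, w)).2) 0 :=
  (analyticAt_axis (F := fun x => (inCoordinates H K X x).2)
    (analyticAt_snd.comp (analyticAt_inCoordinates hH hK hK0 hX))).contDiffAt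

theorem transversalJet_add {m : ℕ} {H K X X' : ℂ × ℂ → ℂ × ℂ} {p : ℂ × ℂ}
    (hH : AnalyticAt ℂ H p) (hK : AnalyticAt ℂ K 0) (hK0 : K 0 = p) (hX : AnalyticAt ℂ X p)
    (hX' : AnalyticAt ℂ X' p) :
    transversalJet m H K (X + X') = transversalJet m H K X + transversalJet m H K X' := by
  unfold transversalJet
  rw [← iteratedDeriv_fun_add (contDiffAt_axis_inCoordinates m hH hK hK0 hX)
    (contDiffAt_axis_inCoordinates m hH hK hK0 hX')]
  simp [inCoordinates]

theorem transversalJet_smul {m : ℕ} {H K X : ℂ × ℂ → ℂ × ℂ} (c : ℝ) :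
    transversalJet m H K (c • X) = c • transversalJet m H K X := by
  unfold transversalJet
  have h : (fun w => (inCoordinates H K (c • X) (0, w)).2) =
      fun w => (c : ℂ) * (inCoordinates H K X (0, w)).2 := by
    funext w
    have hc : (c • X) (K (0, w)) = (c : ℂ) • X (K (0, w)) := by simp
    simp only [inCoordinates]
    rw [hc, map_smul]
    simp
  rw [h, iteratedDeriv_const_mul_field, Complex.real_smul]

/-- At a non-resonant point, an infinitesimal automorphism with vanishing transversal jet
vanishes. -/
theorem IsInfinitesimalAutomorphism.eventuallyEq_zero {m : ℕ} (hm : 2 ≤ m) {M : Set (ℂ × ℂ)}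
    {p : ℂ × ℂ} {H K : ℂ × ℂ → ℂ × ℂ} {ε : ℝ} {R Θ Φ : ℂ × ℂ × ℂ → ℂ} {X : ℂ × ℂ → ℂ × ℂ}
    (hadm : IsAdmissible m M p H ε R)
    (hΘ : IsComplexDefiningFunction (admissibleFunction m ε R) Θ)
    (hΦ : IsAssociatedODE m Θ Φ) (hres : IsUnit (resonanceMatrix Φ))
    (hK : AnalyticAt ℂ K 0) (hK0 : K 0 = p) (hHK : ∀ᶠ x in 𝓝 0, H (K x) = x)
    (hKH : ∀ᶠ Z in 𝓝 p, K (H Z) = Z)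
    (hX : IsInfinitesimalAutomorphism M p X) (hjet : transversalJet m H K X = 0) :
    X =ᶠ[𝓝 p] fun _ => 0 := by
  have hε : ε ≠ 0 := by
    rcases hadm.sign with h | h <;> rw [h] <;> norm_num
  have hY := analyticAt_inCoordinates hadm.coord.analytic hK hK0 hX.1
  set P : ℂ × ℂ → ℂ := fun x => (inCoordinates H K X x).1
  set Q : ℂ × ℂ → ℂ := fun x => (inCoordinates H K X x).2
  have hP : AnalyticAt ℂ P 0 := analyticAt_fst.comp hY
  have hQ : AnalyticAt ℂ Q 0 := analyticAt_snd.comp hY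
  have hKt : Tendsto K (𝓝 0) (𝓝 p) := by simpa [ContinuousAt, hK0] using hK.continuousAt
  have htan := hX.segre_tangent hadm hΘ hKt hHK hP hQ (Eventually.of_forall fun x => rfl)
  have hstar : ∀ {f : ℂ × ℂ → ℂ}, AnalyticAt ℂ f 0 → ContinuousAt (star ∘ f ∘ star) 0 := by
    intro f hf
    have h1 : ContinuousAt f (star (0 : ℂ × ℂ)) := by
      rw [star_zero]
      exact hf.continuousAt
    exact continuous_star.continuousAt.comp (h1.comp continuous_star.continuousAt)
  obtain ⟨hDE, C, hbd⟩ := determiningEquation_of_segre hm hε hadm.real.1 hΘ hΦ hP hQ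
    (hstar hP) (hstar hQ) htan
  obtain ⟨hP0, hQ0⟩ := DeterminingEquation.eventually_eq_zero hm hΦ.analytic hΦ.order_two hres
    hP hQ hDE hbd hjet
  have hHt : Tendsto H (𝓝 p) (𝓝 0) := by
    simpa [ContinuousAt, hadm.coord.center] using hadm.coord.analytic.continuousAt
  filter_upwards [hHt.eventually hP0, hHt.eventually hQ0, hKH.eventually_nhds,
    hadm.coord.analytic.eventually_analyticAt, hHt.eventually hK.eventually_analyticAt]
    with Z h1 h2 h3 h4 h5
  have h6 : fderiv ℂ H Z (X Z) = 0 := by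
    have h7 : inCoordinates H K X (H Z) = 0 := Prod.ext h1 h2
    simpa only [inCoordinates, h3.self_of_nhds] using h7
  -- Differentiating `K ∘ H = id` shows that `fderiv ℂ H Z` is injective.
  have hid := (h5.differentiableAt.hasFDerivAt.comp Z h4.differentiableAt.hasFDerivAt).unique
    ((hasFDerivAt_id Z).congr_of_eventuallyEq h3)
  have := DFunLike.congr_fun hid (X Z)
  simpa [h6] using this.symm

/-- The transversal jet as a linear functional on `𝔞𝔲𝔱 (M, p)`. -/
noncomputable def autJet (m : ℕ) {M : Set (ℂ × ℂ)} {p : ℂ × ℂ} {H K : ℂ × ℂ → ℂ × ℂ}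
    (hH : AnalyticAt ℂ H p) (hK : AnalyticAt ℂ K 0) (hK0 : K 0 = p) : aut M p →ₗ[ℝ] ℂ where
  toFun g := transversalJet m H K g.2.choose
  map_add' g g' := by
    have hKt : Tendsto K (𝓝 0) (𝓝 p) := by simpa [ContinuousAt, hK0] using hK.continuousAt
    rw [← transversalJet_add hH hK hK0 g.2.choose_spec.1.1 g'.2.choose_spec.1.1]
    refine transversalJet_congr hKt (Germ.coe_eq.1 ?_)
    rw [(g + g').2.choose_spec.2, Germ.coe_add, g.2.choose_spec.2, g'.2.choose_spec.2]
    rfl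
  map_smul' c g := by
    have hKt : Tendsto K (𝓝 0) (𝓝 p) := by simpa [ContinuousAt, hK0] using hK.continuousAt
    rw [RingHom.id_apply, ← transversalJet_smul]
    refine transversalJet_congr hKt (Germ.coe_eq.1 ?_)
    rw [(c • g).2.choose_spec.2, Germ.coe_smul, g.2.choose_spec.2]
    rfl

/-- The transversal jet is an injective real-linear map into `ℂ`, which has real dimension 2. -/
theorem rank_aut_le {m : ℕ} (hm : 2 ≤ m) {M : Set (ℂ × ℂ)} {p : ℂ × ℂ}
    (hres : IsNonResonantAt m M p) : Module.rank ℝ (aut M p) ≤ 2 := by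
  obtain ⟨H, ε, R, Θ, Φ, hadm, hΘ, hΦ, hunit, -⟩ := hres
  obtain ⟨K, hK, hK0, hHK, hKH⟩ := hadm.coord.exists_inverse
  have hinj : Function.Injective (autJet m (M := M) hadm.coord.analytic hK hK0) := by
    rw [injective_iff_map_eq_zero]
    intro g hg
    have h := g.2.choose_spec.1.eventuallyEq_zero hm hadm hΘ hΦ hunit hK hK0 hHK hKH hg
    apply Subtype.ext
    rw [← g.2.choose_spec.2]
    exact Germ.coe_eq.2 h
  have := LinearMap.rank_le_of_injective _ hinj
  rwa [Complex.rank_real_complex] at this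

end Jet

end InfiniteType

theorem mainTheorem7 (m : ℕ) (hm : 2 ≤ m) (M : Set (ℂ × ℂ)) (p : ℂ × ℂ)
    (hM : InfiniteType.IsRealAnalyticHypersurfaceAt M p)
    (htype : InfiniteType.IsGenericInfiniteType m M p)
    (hres : InfiniteType.IsNonResonantAt m M p) :
    Module.rank ℝ (InfiniteType.aut M p) ≤ 3 ∧
      Module.rank ℝ (InfiniteType.isotropy M p) ≤ 3 := by
  have h := (InfiniteType.rank_aut_le hm hres).trans
    (by exact_mod_cast (by norm_num : 2 ≤ 3) : (2 : Cardinal) ≤ 3)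
  have hle : InfiniteType.isotropy M p ≤ InfiniteType.aut M p := fun _ hg => hg.1
  exact ⟨h, (Submodule.rank_mono hle).trans h⟩
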